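/- All manifolds are smooth, finite-dimensional, Hausdorff and without boundary. Let $\pi : M \to B$ be a smooth fiber bundle with typical fiber $F$, and let $\mathcal V = \ker d\pi \subset TM$ be its vertical bundle. Let $\xi \subset TM$ be a co-oriented codimension 1 distribution, i.e. $\xi = \ker \alpha$ for some nowhere zero smooth 1-form $\alpha$, where $\alpha$ and $\alpha'$ give the same co-orientation if and only if $\alpha' = g\alpha$ for a positive function $g$. Suppose that for every $b \in B$ the intersection $\xi \cap TF_b$ is a contact distribution on the fiber $F_b = \pi^{-1}(b)$, i.e. it is the kernel of a nowhere zero smooth 1-form $\beta$ on $F_b$ such that $d\beta$ is nondegenerate on $\ker\beta$. Give $\xi\cap TF_b$ the co-orientation induced by that of $\xi$. Then the following hold. 1. There is a connection $\mathcal H$ on $\pi$ (a smooth subbundle of $TM$ with $TM = \mathcal H \oplus \mathcal V$) such that, for every smooth 1-form $\alpha$ on $M$ with $\ker\alpha = \xi$, $$\mathcal H_m = (\xi_m\cap\mathcal V_m)^{d\alpha|_\xi} = \{u \in \xi_m \mid d\alpha(u,w) = 0 \text{ for all } w \in \xi_m \cap \mathcal V_m\} \qquad (m \in M);$$ in particular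 $\mathcal H$ depends only on $\pi$ and $\xi$, and not on the choice of $\alpha$. 2. The parallel transport with respect to $\mathcal H$, where it exists, preserves the contact structures on the fibers and their co-orientations. Precisely, let $\gamma : [0,1] \to B$ be a smooth path, let $D \subset F_{\gamma(0)}$ be open, and suppose that every $m\in D$ is the starting point of a horizontal lift $t \mapsto \mathcal P_t(m)$, $t\in[0,1]$, of $\gamma$ (a curve over $\gamma$ with velocity in $\mathcal H$). Then for every $t \in [0,1]$ the map $\mathcal P_t : D \to F_{\gamma(t)}$ is smooth and injective, its differential maps $\xi \cap TF_{\gamma(0)}$ onto $\xi\cap TF_{\gamma(t)}$ at each point of $D$, and it pulls covectors on $F_{\gamma(t)}$ that are positive for the co-orientation back to positive covectors on $F_{\gamma(0)}$. If $\mathcal H$ is complete (every smooth path $[0,1]\to B$ has a horizontal lift on $[0,1]$ from each point over its starting point) and $D = F_{\gamma(0)}$, then $\mathcal P_t : F_{\gamma(0)} \to F_{\gamma(t)}$ is moreover a diffeomorphism. -/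

import Mathlib

open scoped Manifold ContDiff Topology

noncomputable section

namespace ContactBundle

section Distributions

variable {E : Type*} [NormedAddCommGroup E] [NormedSpace ℝ E]
  {M : Type*} [TopologicalSpace M] [ChartedSpace E M]

/-- A smooth 1-form: a family of covectors which, viewed as a fibrewise linear function on the
tangent bundle, is smooth. -/
def IsSmoothOneForm [IsManifold 𝓘(ℝ, E) ∞ M]
    (α : ∀ m : M, TangentSpace 𝓘(ℝ, E) m →L[ℝ] ℝ) : Prop :=
  ContMDiff (𝓘(ℝ, E).tangent) 𝓘(ℝ, ℝ) ∞ (fun p : TangentBundle 𝓘(ℝ, E) M ↦ α p.1 p.2)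

/-- The 1-form `α` read in the preferred chart at `m`, i.e. its pullback under the inverse chart. -/
def oneFormInChart (α : ∀ m : M, TangentSpace 𝓘(ℝ, E) m →L[ℝ] ℝ) (m : M) (x : E) : E →L[ℝ] ℝ :=
  (α ((extChartAt 𝓘(ℝ, E) m).symm x)).comp
    (mfderiv 𝓘(ℝ, E) 𝓘(ℝ, E) (extChartAt 𝓘(ℝ, E) m).symm x)

/-- The exterior derivative `dα` of a 1-form, at `m`, evaluated on two tangent vectors, computed in
the preferred chart at `m`; convention `dα(X, Y) = X (α Y) - Y (α X) - α [X, Y]`. -/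
def extDerivOneForm (α : ∀ m : M, TangentSpace 𝓘(ℝ, E) m →L[ℝ] ℝ) (m : M)
    (u v : TangentSpace 𝓘(ℝ, E) m) : ℝ :=
  let φ := extChartAt 𝓘(ℝ, E) m
  let u' : E := mfderiv 𝓘(ℝ, E) 𝓘(ℝ, E) φ m u
  let v' : E := mfderiv 𝓘(ℝ, E) 𝓘(ℝ, E) φ m v
  fderiv ℝ (oneFormInChart α m) (φ m) u' v' - fderiv ℝ (oneFormInChart α m) (φ m) v' u'

variable (E M) in
/-- The data of a field of subspaces `ξ ⊆ TM` together with a set of covectors `ξ°₊` at each point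
(meant to be the chosen half of the annihilator of `ξ`, minus zero). -/
structure CoorientedField where
  /-- the subspace `ξ_m` -/
  plane : ∀ m : M, Submodule ℝ (TangentSpace 𝓘(ℝ, E) m)
  /-- the positive covectors at `m` -/
  positive : ∀ m : M, Set (TangentSpace 𝓘(ℝ, E) m →L[ℝ] ℝ)

namespace CoorientedField

variable [IsManifold 𝓘(ℝ, E) ∞ M] (ξ : CoorientedField E M)

/-- `α` is a smooth 1-form with `ker α = ξ`. -/
def IsKernelForm (α : ∀ m : M, TangentSpace 𝓘(ℝ, E) m →L[ℝ] ℝ) : Prop :=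
  IsSmoothOneForm α ∧ ∀ m, ξ.plane m = LinearMap.ker (α m).toLinearMap

/-- `α` is a nowhere zero smooth 1-form with `ker α = ξ` that gives `ξ` its co-orientation. -/
def IsDefinedBy (α : ∀ m : M, TangentSpace 𝓘(ℝ, E) m →L[ℝ] ℝ) : Prop :=
  ξ.IsKernelForm α ∧ ∀ m, α m ≠ 0 ∧ ξ.positive m = {ℓ | ∃ c : ℝ, 0 < c ∧ ℓ = c • α m}

/-- `ξ` is a (smooth) co-oriented codimension 1 distribution. -/
def IsCoorientedDistribution : Prop := ∃ α, ξ.IsDefinedBy α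

/-- `ξ` is a co-oriented contact distribution: `ξ = ker α` for a nowhere zero smooth 1-form `α`
(giving the co-orientation) such that `dα` is nondegenerate on `ξ`. -/
def IsContact : Prop :=
  ∃ α, ξ.IsDefinedBy α ∧ ∀ m, ∀ u ∈ ξ.plane m,
    (∀ v ∈ ξ.plane m, extDerivOneForm α m u v = 0) → u = 0

end CoorientedField

/-- A smooth vector subbundle of `TM`: a field of subspaces with smooth local frames. -/
def IsSmoothSubbundle [IsManifold 𝓘(ℝ, E) ∞ M]
    (H : ∀ m : M, Submodule ℝ (TangentSpace 𝓘(ℝ, E) m)) : Prop :=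
  ∀ m₀ : M, ∃ U : Set M, IsOpen U ∧ m₀ ∈ U ∧ ∃ (k : ℕ)
    (X : Fin k → ∀ m : M, TangentSpace 𝓘(ℝ, E) m),
    (∀ i, ContMDiffOn 𝓘(ℝ, E) 𝓘(ℝ, E).tangent ∞
      (fun m ↦ (⟨m, X i m⟩ : TangentBundle 𝓘(ℝ, E) M)) U) ∧
    ∀ m ∈ U, LinearIndependent ℝ (fun i ↦ X i m) ∧
      Submodule.span ℝ (Set.range fun i ↦ X i m) = H m

end Distributions

section Maps

variable {E E' : Type*} [NormedAddCommGroup E] [NormedSpace ℝ E]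
  [NormedAddCommGroup E'] [NormedSpace ℝ E']
  {M N : Type*} [TopologicalSpace M] [ChartedSpace E M] [TopologicalSpace N] [ChartedSpace E' N]

variable (E') in
/-- Pullback of a co-oriented field under a map `ι : N → M`. When `ι` parametrizes a submanifold,
this is `ξ ∩ TN` with the restricted co-orientation. -/
def CoorientedField.pullback (ξ : CoorientedField E M) (ι : N → M) : CoorientedField E' N where
  plane n := (ξ.plane (ι n)).comap (mfderiv 𝓘(ℝ, E') 𝓘(ℝ, E) ι n).toLinearMap
  positive n := {ℓ | ∃ k ∈ ξ.positive (ι n), ℓ = k.comp (mfderiv 𝓘(ℝ, E') 𝓘(ℝ, E) ι n)}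

/-- At every point of `s` the differential of `φ` maps `ξ₀` onto `ξ₁`, and pulls positive covectors
of `ξ₁` back to positive covectors of `ξ₀`. -/
def PreservesOn (ξ₀ : CoorientedField E M) (ξ₁ : CoorientedField E' N) (φ : M → N) (s : Set M) :
    Prop :=
  ∀ m ∈ s,
    (ξ₀.plane m).map (mfderiv 𝓘(ℝ, E) 𝓘(ℝ, E') φ m).toLinearMap = ξ₁.plane (φ m) ∧
    ∀ ℓ ∈ ξ₁.positive (φ m), ℓ.comp (mfderiv 𝓘(ℝ, E) 𝓘(ℝ, E') φ m) ∈ ξ₀.positive m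

end Maps

section Bundles

variable {EM EB EF : Type*} [NormedAddCommGroup EM] [NormedSpace ℝ EM]
  [NormedAddCommGroup EB] [NormedSpace ℝ EB] [NormedAddCommGroup EF] [NormedSpace ℝ EF]
  {M B F : Type*} [TopologicalSpace M] [ChartedSpace EM M] [TopologicalSpace B] [ChartedSpace EB B]
  [TopologicalSpace F] [ChartedSpace EF F]

variable (EM EB EF F) in
/-- A smooth local trivialization of `π : M → B` with fibre `F`. -/
structure SmoothTrivialization (π : M → B) extends Bundle.Trivialization F π where
  contMDiffOn_toFun : ContMDiffOn 𝓘(ℝ, EM) (𝓘(ℝ, EB).prod 𝓘(ℝ, EF)) ∞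
    toOpenPartialHomeomorph source
  contMDiffOn_invFun : ContMDiffOn (𝓘(ℝ, EB).prod 𝓘(ℝ, EF)) 𝓘(ℝ, EM) ∞
    toOpenPartialHomeomorph.symm target

/-- For `b` in the base set of `e`: the diffeomorphism from `F` onto the fibre over `b` given by
the trivialization, as a map into the total space. -/
def SmoothTrivialization.param {π : M → B} (e : SmoothTrivialization EM EB EF F π) (b : B) :
    F → M :=
  fun f ↦ e.toOpenPartialHomeomorph.symm (b, f)

/-- The fibre component of the trivialization. -/
def SmoothTrivialization.coord {π : M → B} (e : SmoothTrivialization EM EB EF F π) : M → F :=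
  fun m ↦ (e.toOpenPartialHomeomorph m).2

variable (EM EB EF F) in
/-- `π : M → B` is a smooth fibre bundle with typical fibre `F`. -/
def IsSmoothFiberBundle (π : M → B) : Prop :=
  ∀ b : B, ∃ e : SmoothTrivialization EM EB EF F π, b ∈ e.baseSet

variable (EM EB) in
/-- The vertical subspace `V_m = ker dπ_m`. -/
def vertical (π : M → B) (m : M) : Submodule ℝ (TangentSpace 𝓘(ℝ, EM) m) :=
  LinearMap.ker (mfderiv 𝓘(ℝ, EM) 𝓘(ℝ, EB) π m).toLinearMap

variable (EB EF F) in
/-- For every `b`, the intersection of `ξ` with the tangent spaces of the fibre over `b` is a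
contact distribution on that fibre, the fibre being identified with `F` by a trivialization. -/
def IsContactOnFibers [IsManifold 𝓘(ℝ, EF) ∞ F] (π : M → B) (ξ : CoorientedField EM M) : Prop :=
  ∀ b : B, ∃ e : SmoothTrivialization EM EB EF F π, b ∈ e.baseSet ∧
    (ξ.pullback EF (e.param b)).IsContact

variable (EB) in
/-- The perpendicular `(ξ ∩ V)^ω` of `ξ ∩ V` inside `(ξ, ω)`, where `ω = dα|_ξ`, at the point `m`,
as a set of tangent vectors. -/
def contactPerp (π : M → B) (ξ : CoorientedField EM M)
    (α : ∀ m : M, TangentSpace 𝓘(ℝ, EM) m →L[ℝ] ℝ) (m : M) : Set (TangentSpace 𝓘(ℝ, EM) m) :=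
  {u | u ∈ ξ.plane m ∧ ∀ w ∈ ξ.plane m ⊓ vertical EM EB π m, extDerivOneForm α m u w = 0}

variable (EB) in
/-- A connection on `π`: a smooth subbundle of `TM` complementary to the vertical bundle. -/
def IsConnection [IsManifold 𝓘(ℝ, EM) ∞ M] (π : M → B)
    (H : ∀ m : M, Submodule ℝ (TangentSpace 𝓘(ℝ, EM) m)) : Prop :=
  IsSmoothSubbundle H ∧ ∀ m, IsCompl (H m) (vertical EM EB π m)

/-- `c` is a horizontal lift of the path `γ` over the unit interval: it lies over `γ` and has
velocity in `H`. -/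
def IsHorizontalLift (π : M → B) (H : ∀ m : M, Submodule ℝ (TangentSpace 𝓘(ℝ, EM) m))
    (γ : ℝ → B) (c : ℝ → M) : Prop :=
  ∀ t ∈ Set.Icc (0 : ℝ) 1, π (c t) = γ t ∧ ∃ v ∈ H (c t),
    HasMFDerivWithinAt 𝓘(ℝ, ℝ) 𝓘(ℝ, EM) c (Set.Icc 0 1) t
      ((1 : ℝ →L[ℝ] ℝ).smulRight v)

/-- `P t`, for `t ∈ [0, 1]`, is the parallel transport along `γ` on the subset `D` of the fibre over
`γ 0`: each point of `D` moves along a horizontal lift of `γ`. Values of `P` off `[0, 1]` and `D`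
are irrelevant. -/
def IsParallelTransportOn (π : M → B) (H : ∀ m : M, Submodule ℝ (TangentSpace 𝓘(ℝ, EM) m))
    (γ : ℝ → B) (D : Set M) (P : ℝ → M → M) : Prop :=
  ∀ m ∈ D, P 0 m = m ∧ IsHorizontalLift π H γ (fun t ↦ P t m)

variable (EB) in
/-- The connection `H` is complete: every smooth path in the base has a horizontal lift through
every point over its starting point. -/
def IsCompleteConnection (π : M → B) (H : ∀ m : M, Submodule ℝ (TangentSpace 𝓘(ℝ, EM) m)) :
    Prop :=
  ∀ γ : ℝ → B, ContMDiffOn 𝓘(ℝ, ℝ) 𝓘(ℝ, EB) ∞ γ (Set.Icc 0 1) →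
    ∀ m, π m = γ 0 → ∃ c : ℝ → M, c 0 = m ∧ IsHorizontalLift π H γ c

end Bundles

end ContactBundle

end

/-!
Fix a form `α` defining `ξ` and put `V = ker dπ`. The connection is the perpendicular of `ξ ∩ V` in
`(ξ, dα|ξ)` (`contactConnection`). Two forms with kernel `ξ` differ by a nonvanishing function `g`,
so that their exterior derivatives on `ξ` differ by the factor `g`, and the perpendicular does not
see the difference (`CoorientedField.IsKernelForm.contactPerp_eq`).

*The connection.* In a chart of `M` adapted to `π` the form becomes a form `A` on an open subset of
`EB × EF`, whose restriction `β` to each slice `{x} × EF` is a contact form. The contact condition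
makes the bilinear form `dβ + β ⊗ β` nondegenerate. Its inverse depends smoothly on the point and
yields the Reeb vector `R` of the slice and a smooth family of linear maps `X : EB → EF` with the
horizontal spaces as graphs (`IsFiberContactForm.exists_horizontal`). So the perpendicular is a
smooth complement of `V` (`isConnection_contactConnection`).

*Conformality.* Horizontal lifts of a path with chart expression `q` solve `y' = X (q, y) q'`. Let
`j` be a solution of the variational equation along such a lift. As `A (v, X v) = 0` identically,
the derivative of `A (0, j)` is `dA ((q', y'), (0, j))` (Cartan's formula). By the definition of the
horizontal space this vanishes if `A (0, j) = 0`, hence it equals `μ A (0, j)` with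
`μ = dA ((q', y'), (0, R))`. Therefore `A (0, j)` is multiplied by the positive number `exp (∫ μ)`,
which does not depend on `j` (`IsFiberContactForm.exists_pos_scaling`).

*Smoothness.* Over a short time interval the equation in integrated form is `u - ∫ f u = const z` in
the Banach space of continuous curves. Superposition operators of smooth maps are smooth
(`contDiffOn_superposition`), and the inverse function theorem gives a solution which depends
smoothly on `z`, and whose derivative solves the variational equation (`exists_localFlow`).

*From short to long times.* Horizontal lifts are determined by their value at one time
(`IsHorizontalLiftOn.eqOn`), so near a given lift every parallel transport agrees with the local
flows just found (`IsHorizontalLift.exists_local_transport`). Smoothness, injectivity of the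
differential and positive rescaling of `α` thus propagate between nearby times, and the unit
interval is connected (`IsParallelTransportOn.isConformalAt`). Uniqueness of lifts also gives
injectivity of the transport. For a complete connection, transport along the reversed path is a
smooth inverse (`IsParallelTransportOn.exists_diffeomorph`).
-/

noncomputable section

namespace ContactBundle

open Set

set_option linter.unusedSectionVars false

/-! ### Superposition operators -/

section Superposition

variable {K : Type*} [TopologicalSpace K] [CompactSpace K]
  {E₁ E₂ : Type*} [NormedAddCommGroup E₁] [NormedSpace ℝ E₁] [NormedAddCommGroup E₂]
  [NormedSpace ℝ E₂]

variable (K E₁ E₂) in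
/-- Pointwise application of a continuous family of continuous linear maps to a continuous family
of vectors. -/
def pointwiseApply : C(K, E₁ →L[ℝ] E₂) →L[ℝ] C(K, E₁) →L[ℝ] C(K, E₂) :=
  LinearMap.mkContinuous₂
    (LinearMap.mk₂ ℝ
      (fun (T : C(K, E₁ →L[ℝ] E₂)) (h : C(K, E₁)) ↦
        (⟨fun k ↦ T k (h k), T.continuous.clm_apply h.continuous⟩ : C(K, E₂)))
      (fun _ _ _ ↦ by ext; simp) (fun _ _ _ ↦ by ext; simp)
      (fun _ _ _ ↦ by ext; simp) (fun _ _ _ ↦ by ext; simp)) 1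
    (fun T h ↦ by
      rw [one_mul]
      refine (ContinuousMap.norm_le _ (by positivity)).2 fun k ↦ ?_
      exact ((T k).le_opNorm _).trans
        (mul_le_mul (T.norm_coe_le_norm k) (h.norm_coe_le_norm k) (norm_nonneg _) (norm_nonneg T)))

@[simp]
theorem pointwiseApply_apply (T : C(K, E₁ →L[ℝ] E₂)) (h : C(K, E₁)) (k : K) :
    pointwiseApply K E₁ E₂ T h k = T k (h k) := rfl

open Classical in
/-- The superposition operator `w ↦ X ∘ w` on continuous functions, with value `0` at those `w` for
which `X ∘ w` fails to be continuous. -/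
def superposition (X : E₁ → E₂) (w : C(K, E₁)) : C(K, E₂) :=
  if h : Continuous (X ∘ w) then ⟨X ∘ w, h⟩ else 0

theorem superposition_apply {X : E₁ → E₂} {U : Set E₁} (hX : ContinuousOn X U) {w : C(K, E₁)}
    (hw : ∀ k, w k ∈ U) (k : K) : superposition X w k = X (w k) := by
  have h : Continuous (X ∘ w) := hX.comp_continuous w.continuous hw
  simp [superposition, h]

theorem isOpen_setOf_forall_mem {U : Set E₁} (hU : IsOpen U) :
    IsOpen {w : C(K, E₁) | ∀ k, w k ∈ U} := by
  have := ContinuousMap.isOpen_setOfPred_mapsTo (X := K) isCompact_univ hU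
  simpa [MapsTo] using this

/-- Uniform continuity around the compact image of a continuous function `w`. -/
theorem exists_delta_of_continuousOn {X : E₁ → E₂} {U : Set E₁} (hU : IsOpen U)
    (hX : ContinuousOn X U) {w : C(K, E₁)} (hw : ∀ k, w k ∈ U) {ε : ℝ} (hε : 0 < ε) :
    ∃ δ > 0, ∀ k, ∀ y ∈ Metric.ball (w k) δ, y ∈ U ∧ ‖X y - X (w k)‖ ≤ ε := by
  have hc : IsCompact (range w) := isCompact_range w.continuous
  have hsub : range w ⊆ U := by rintro _ ⟨k, rfl⟩; exact hw k
  obtain ⟨δ₁, h₁, hδ₁⟩ := hc.exists_thickening_subset_open hU hsub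
  have := hc.uniformContinuousAt_of_continuousAt X
    (fun x hx ↦ hX.continuousAt (hU.mem_nhds (hsub hx))) (Metric.dist_mem_uniformity hε)
  obtain ⟨δ₂, h₂, hδ₂⟩ := Metric.mem_uniformity_dist.1 this
  refine ⟨min δ₁ δ₂, lt_min h₁ h₂, fun k y hy ↦ ⟨?_, ?_⟩⟩
  · exact hδ₁ (Metric.mem_thickening_iff.2
      ⟨w k, mem_range_self k, lt_of_lt_of_le hy (min_le_left _ _)⟩)
  · have h := @hδ₂ (w k) y (by rw [dist_comm]; exact lt_of_lt_of_le hy (min_le_right _ _))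
      (mem_range_self k)
    rw [← dist_eq_norm, dist_comm]
    exact le_of_lt h

theorem continuousOn_superposition {X : E₁ → E₂} {U : Set E₁} (hU : IsOpen U)
    (hX : ContinuousOn X U) :
    ContinuousOn (superposition (K := K) X) {w | ∀ k, w k ∈ U} := by
  intro w hw
  refine ContinuousAt.continuousWithinAt (Metric.continuousAt_iff.2 fun ε hε ↦ ?_)
  obtain ⟨δ, hδ, H⟩ := exists_delta_of_continuousOn hU hX hw (half_pos hε)
  refine ⟨δ, hδ, fun {v} hv ↦ ?_⟩
  have hv' : ∀ k, v k ∈ Metric.ball (w k) δ := fun k ↦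
    lt_of_le_of_lt (ContinuousMap.dist_apply_le_dist k) hv
  refine lt_of_le_of_lt ((ContinuousMap.dist_le (half_pos hε).le).2 fun k ↦ ?_) (half_lt_self hε)
  rw [superposition_apply hX hw, superposition_apply hX fun k ↦ (H k _ (hv' k)).1, dist_eq_norm]
  exact (H k _ (hv' k)).2

theorem hasFDerivAt_superposition {X : E₁ → E₂} {U : Set E₁} (hU : IsOpen U)
    (hX : DifferentiableOn ℝ X U) (hX' : ContinuousOn (fderiv ℝ X) U) {w : C(K, E₁)}
    (hw : ∀ k, w k ∈ U) :
    HasFDerivAt (superposition (K := K) X)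
      (pointwiseApply K E₁ E₂ (superposition (fderiv ℝ X) w)) w := by
  rw [hasFDerivAt_iff_isLittleO_nhds_zero, Asymptotics.isLittleO_iff]
  intro ε hε
  obtain ⟨δ, hδ, H⟩ := exists_delta_of_continuousOn hU hX' hw hε
  filter_upwards [Metric.ball_mem_nhds (0 : C(K, E₁)) hδ] with h hh
  have hh' : ∀ k, w k + h k ∈ Metric.ball (w k) δ := fun k ↦ by
    rw [mem_ball_iff_norm, add_sub_cancel_left]
    exact lt_of_le_of_lt (h.norm_coe_le_norm k) (by simpa using hh)
  refine (ContinuousMap.norm_le _ (by positivity)).2 fun k ↦ ?_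
  have h₁ : ∀ k, (w + h) k ∈ U := fun k ↦ (H k _ (hh' k)).1
  rw [ContinuousMap.sub_apply, ContinuousMap.sub_apply, superposition_apply hX.continuousOn h₁,
    superposition_apply hX.continuousOn hw, pointwiseApply_apply, superposition_apply hX' hw]
  have := (convex_ball (w k) δ).norm_image_sub_le_of_norm_hasFDerivWithin_le'
    (f := X) (f' := fderiv ℝ X) (φ := fderiv ℝ X (w k)) (C := ε)
    (fun x hx ↦ ((hX x (H k x hx).1).differentiableAt
      (hU.mem_nhds (H k x hx).1)).hasFDerivAt.hasFDerivWithinAt)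
    (fun x hx ↦ (H k x hx).2) (Metric.mem_ball_self hδ) (hh' k)
  rw [add_sub_cancel_left] at this
  exact this.trans (mul_le_mul_of_nonneg_left (h.norm_coe_le_norm k) hε.le)

end Superposition

section SuperpositionSmooth

universe u

variable {K : Type*} [TopologicalSpace K] [CompactSpace K]
  {E₁ : Type u} [NormedAddCommGroup E₁] [NormedSpace ℝ E₁]

/-- Finite order smoothness of the superposition operator, by induction on the order: its derivative
is pointwise application of the superposition operator of the derivative. The induction changes the
target space to `E₁ →L[ℝ] E₂`, whence the common universe. -/
theorem contDiffOn_nat_superposition {U : Set E₁} (hU : IsOpen U) (n : ℕ) :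
    ∀ {E₂ : Type u} [NormedAddCommGroup E₂] [NormedSpace ℝ E₂] {X : E₁ → E₂},
      ContDiffOn ℝ n X U → ContDiffOn ℝ n (superposition (K := K) X) {w | ∀ k, w k ∈ U} := by
  induction n with
  | zero =>
    intro E₂ _ _ X hX
    exact contDiffOn_zero.2 (continuousOn_superposition hU (contDiffOn_zero.1 hX))
  | succ n ih =>
    intro E₂ _ _ X hX
    push_cast at hX ⊢
    obtain ⟨hd, -, hd'⟩ := (contDiffOn_succ_iff_fderiv_of_isOpen hU).1 hX
    have key : ∀ w ∈ {w : C(K, E₁) | ∀ k, w k ∈ U}, HasFDerivAt (superposition (K := K) X)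
        (pointwiseApply K E₁ E₂ (superposition (fderiv ℝ X) w)) w :=
      fun w hw ↦ hasFDerivAt_superposition hU hd hd'.continuousOn hw
    refine (contDiffOn_succ_iff_fderiv_of_isOpen (isOpen_setOf_forall_mem hU)).2
      ⟨fun w hw ↦ (key w hw).differentiableAt.differentiableWithinAt, by simp, ?_⟩
    refine ContDiffOn.congr (f := fun w ↦ pointwiseApply K E₁ E₂ (superposition (fderiv ℝ X) w))
      ?_ fun w hw ↦ (key w hw).fderiv
    exact (pointwiseApply K E₁ E₂).contDiff.comp_contDiffOn (ih hd')

/-- The superposition operator of a smooth map is smooth for the sup norm. -/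
theorem contDiffOn_superposition {U : Set E₁} (hU : IsOpen U)
    {E₂ : Type u} [NormedAddCommGroup E₂] [NormedSpace ℝ E₂] {X : E₁ → E₂}
    (hX : ContDiffOn ℝ ∞ X U) :
    ContDiffOn ℝ ∞ (superposition (K := K) X) {w | ∀ k, w k ∈ U} :=
  contDiffOn_infty.2 fun n ↦
    contDiffOn_nat_superposition hU n (hX.of_le (by exact_mod_cast le_top))

end SuperpositionSmooth

/-! ### Smooth short-time flows of time-dependent vector fields -/

section LocalFlow

variable {E : Type*} [NormedAddCommGroup E] [NormedSpace ℝ E] [CompleteSpace E]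
  {a b : ℝ}

/-- The Volterra operator `g ↦ ∫_s^t g` on continuous functions on `[a, b]`. -/
def volterra (hab : a ≤ b) (s : Icc a b) : C(Icc a b, E) →L[ℝ] C(Icc a b, E) :=
  LinearMap.mkContinuous
    { toFun := fun g ↦ ⟨fun t ↦ ∫ τ in (s : ℝ)..t, IccExtend hab g τ,
        (intervalIntegral.differentiable_integral_of_continuous
          (g.continuous.Icc_extend' (h := hab))).continuous.comp continuous_subtype_val⟩
      map_add' := fun g h ↦ by
        ext t
        have hg := g.continuous.Icc_extend' (h := hab)
        have hh := h.continuous.Icc_extend' (h := hab)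
        simp only [ContinuousMap.coe_mk, ContinuousMap.add_apply]
        rw [← intervalIntegral.integral_add (hg.intervalIntegrable _ _)
          (hh.intervalIntegrable _ _)]
        rfl
      map_smul' := fun c g ↦ by
        ext t
        simp only [ContinuousMap.coe_mk, ContinuousMap.smul_apply, RingHom.id_apply]
        rw [← intervalIntegral.integral_smul]
        rfl } (b - a)
    (fun g ↦ by
      have hba : 0 ≤ b - a := sub_nonneg.2 hab
      refine (ContinuousMap.norm_le _ (by positivity)).2 fun t ↦ ?_
      refine (intervalIntegral.norm_integral_le_of_norm_le_const (C := ‖g‖)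
        fun τ _ ↦ g.norm_coe_le_norm _).trans ?_
      rw [mul_comm]
      refine mul_le_mul_of_nonneg_right ?_ (norm_nonneg g)
      rw [abs_le]
      constructor <;> linarith [s.2.1, s.2.2, t.2.1, t.2.2])

theorem volterra_apply (hab : a ≤ b) (s : Icc a b) (g : C(Icc a b, E)) (t : Icc a b) :
    volterra hab s g t = ∫ τ in (s : ℝ)..t, IccExtend hab g τ := rfl

theorem volterra_self (hab : a ≤ b) (s : Icc a b) (g : C(Icc a b, E)) :
    volterra hab s g s = 0 := by
  rw [volterra_apply, intervalIntegral.integral_same]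

theorem norm_volterra_le (hab : a ≤ b) (s : Icc a b) :
    ‖volterra (E := E) hab s‖ ≤ b - a :=
  LinearMap.mkContinuous_norm_le _ (sub_nonneg.2 hab) _

theorem hasDerivWithinAt_volterra (hab : a ≤ b) (s : Icc a b) (g : C(Icc a b, E)) {t : ℝ}
    (ht : t ∈ Icc a b) :
    HasDerivWithinAt (IccExtend hab (volterra hab s g)) (g ⟨t, ht⟩) (Icc a b) t := by
  have hg := g.continuous.Icc_extend' (h := hab)
  have h := (intervalIntegral.integral_hasDerivAt_right (hg.intervalIntegrable s t)
    (hg.stronglyMeasurableAtFilter _ _) hg.continuousAt).hasDerivWithinAt (s := Icc a b)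
  rw [IccExtend_of_mem hab _ ht] at h
  refine h.congr (fun τ hτ ↦ ?_) ?_
  · rw [IccExtend_of_mem hab _ hτ, volterra_apply]
  · rw [IccExtend_of_mem hab _ ht, volterra_apply]

/-- A differential equation on `[a, b]` in integrated form. -/
theorem eq_const_add_volterra_iff (hab : a ≤ b) (s : Icc a b) (u g : C(Icc a b, E)) (z : E) :
    u - volterra hab s g = ContinuousMap.const _ z ↔ u s = z ∧ ∀ t (ht : t ∈ Icc a b),
      HasDerivWithinAt (IccExtend hab u) (g ⟨t, ht⟩) (Icc a b) t := by
  constructor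
  · intro h
    have hu : u = ContinuousMap.const _ z + volterra hab s g := by rw [← h]; abel
    refine ⟨by rw [hu]; simp [volterra_self], fun t ht ↦ ?_⟩
    have h := (hasDerivWithinAt_volterra hab s g ht).const_add z
    refine h.congr (fun τ hτ ↦ ?_) ?_
    · rw [IccExtend_of_mem hab _ hτ, IccExtend_of_mem hab _ hτ, hu]; rfl
    · rw [IccExtend_of_mem hab _ ht, IccExtend_of_mem hab _ ht, hu]; rfl
  · rintro ⟨hs, hd⟩
    ext t
    have h : ∀ τ ∈ Icc a b, HasDerivWithinAt
        (fun τ ↦ IccExtend hab u τ - IccExtend hab (volterra hab s g) τ) 0 (Icc a b) τ := by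
      intro τ hτ
      have := (hd τ hτ).sub (hasDerivWithinAt_volterra hab s g hτ)
      rwa [sub_self] at this
    have := (convex_Icc a b).norm_image_sub_le_of_norm_hasDerivWithin_le (C := 0) h
      (by simp) s.2 t.2
    rw [zero_mul, norm_le_zero_iff, sub_eq_zero] at this
    simp only [IccExtend_val, volterra_self, sub_zero] at this
    simp only [ContinuousMap.sub_apply, ContinuousMap.const_apply]
    rw [this, hs]

end LocalFlow

section LocalFlow

variable {E₁ E₂ : Type*} [NormedAddCommGroup E₁] [NormedSpace ℝ E₁]
  [NormedAddCommGroup E₂] [NormedSpace ℝ E₂] [CompleteSpace E₂] {a b : ℝ}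

/-- Smooth dependence on the initial value for `y' = X (q, y) p`, with its variational equation,
near a given solution `y` over an interval short enough for the linearized Picard operator to be a
contraction. The integrated equation reads `u - ∫_s f(u) = const z` in the Banach space of
continuous curves; its left side is smooth in `u` with invertible derivative at `y`, so the inverse
function theorem gives the solution `u z` with value `z` at time `s`. -/
theorem exists_localFlow (hab : a ≤ b) {U : Set (E₁ × E₂)} (hU : IsOpen U)
    {X : E₁ × E₂ → E₁ →L[ℝ] E₂} (hX : ContDiffOn ℝ ∞ X U) {q p : ℝ → E₁} {y : ℝ → E₂}
    (hq : ContinuousOn q (Icc a b)) (hp : ContinuousOn p (Icc a b))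
    (hyU : ∀ t ∈ Icc a b, (q t, y t) ∈ U)
    (hy : ∀ t ∈ Icc a b, HasDerivWithinAt y (X (q t, y t) (p t)) (Icc a b) t)
    {C : ℝ} (hC : ∀ t ∈ Icc a b, ‖fderiv ℝ X (q t, y t)‖ * ‖p t‖ ≤ C) (hC' : (b - a) * C < 1)
    {s : ℝ} (hs : s ∈ Icc a b) :
    ∃ u : E₂ → ℝ → E₂,
      (∀ᶠ z in 𝓝 (y s), u z s = z ∧ ∀ t ∈ Icc a b, (q t, u z t) ∈ U ∧
        HasDerivWithinAt (u z) (X (q t, u z t) (p t)) (Icc a b) t) ∧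
      (∀ t ∈ Icc a b, u (y s) t = y t) ∧
      (∀ t ∈ Icc a b, ContDiffAt ℝ ∞ (fun z ↦ u z t) (y s)) ∧
      ∀ h : E₂, fderiv ℝ (fun z ↦ u z s) (y s) h = h ∧ ∀ t ∈ Icc a b,
        HasDerivWithinAt (fun t ↦ fderiv ℝ (fun z ↦ u z t) (y s) h)
          (fderiv ℝ X (q t, y t) (0, fderiv ℝ (fun z ↦ u z t) (y s) h) (p t)) (Icc a b) t := by
  have hC0 : 0 ≤ C := (by positivity : (0 : ℝ) ≤ _).trans (hC s hs)
  set K := Icc a b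
  have hyc : ContinuousOn y K := fun t ht ↦ (hy t ht).continuousWithinAt
  let q' : C(K, E₁) := ⟨K.domRestrict q, hq.domRestrict⟩
  let p' : C(K, E₁) := ⟨K.domRestrict p, hp.domRestrict⟩
  let y' : C(K, E₂) := ⟨K.domRestrict y, hyc.domRestrict⟩
  -- the curve `t ↦ (q t, u t)`, affine in `u`
  let J : C(K, E₂) →L[ℝ] C(K, E₁ × E₂) :=
    ContinuousLinearMap.compLeftContinuous ℝ K (ContinuousLinearMap.inr ℝ E₁ E₂)
  let w : C(K, E₂) → C(K, E₁ × E₂) := fun u ↦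
    ContinuousLinearMap.compLeftContinuous ℝ K (ContinuousLinearMap.inl ℝ E₁ E₂) q' + J u
  have hw_apply : ∀ u t, w u t = (q' t, u t) := fun u t ↦ by simp [w, J]
  have hw : ContDiff ℝ ∞ w := contDiff_const.add J.contDiff
  have hw' : ∀ u, HasFDerivAt w J u := fun u ↦ J.hasFDerivAt.const_add _
  let W : Set C(K, E₂) := {u | ∀ t, (q' t, u t) ∈ U}
  have hW_eq : W = w ⁻¹' {v | ∀ t, v t ∈ U} := by
    ext u; simp [W, hw_apply]
  have hW : IsOpen W := hW_eq ▸ (isOpen_setOf_forall_mem hU).preimage hw.continuous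
  have hy'W : y' ∈ W := fun t ↦ hyU t t.2
  -- the right hand side, as an operator on curves
  let app : C(K, E₁ →L[ℝ] E₂) →L[ℝ] C(K, E₂) :=
    ContinuousLinearMap.flip (𝕜 := ℝ) (𝕜₂ := ℝ) (𝕜₃ := ℝ) (σ₂₃ := .id ℝ) (σ₁₃ := .id ℝ)
      (E := C(K, E₁ →L[ℝ] E₂)) (F := C(K, E₁)) (G := C(K, E₂))
      (pointwiseApply K E₁ E₂) p'
  let f : C(K, E₂) → C(K, E₂) := fun u ↦ app (superposition X (w u))
  have hf_apply : ∀ u ∈ W, ∀ t : K, f u t = X (q t, u t) (p t) := fun u hu t ↦ by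
    have : ∀ k, w u k ∈ U := fun k ↦ by rw [hw_apply]; exact hu k
    simp only [f, app, ContinuousLinearMap.flip_apply, pointwiseApply_apply]
    rw [superposition_apply hX.continuousOn this, hw_apply]
    rfl
  have hf : ContDiffOn ℝ ∞ f W := by
    refine app.contDiff.comp_contDiffOn ((contDiffOn_superposition hU hX).comp hw.contDiffOn ?_)
    exact hW_eq.le
  let A : C(K, E₂) →L[ℝ] C(K, E₂) :=
    app ∘L (pointwiseApply K (E₁ × E₂) (E₁ →L[ℝ] E₂) (superposition (fderiv ℝ X) (w y'))) ∘L J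
  have hX' : ContinuousOn (fderiv ℝ X) U := hX.continuousOn_fderiv_of_isOpen hU (by simp)
  have hwy : ∀ k, w y' k ∈ U := fun k ↦ by rw [hw_apply]; exact hy'W k
  have hA_apply : ∀ h t, A h t = fderiv ℝ X (q t, y t) (0, h t) (p t) := fun h t ↦ by
    simp only [A, app, ContinuousLinearMap.comp_apply, ContinuousLinearMap.flip_apply,
      pointwiseApply_apply]
    rw [superposition_apply hX' hwy, hw_apply]
    simp [J]
    rfl
  have hfA : HasFDerivAt f A y' := by
    have h₁ := hasFDerivAt_superposition hU (hX.differentiableOn (by simp)) hX' hwy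
    exact app.hasFDerivAt.comp y' (h₁.comp y' (hw' y'))
  have hA : ‖A‖ ≤ C := by
    refine A.opNorm_le_bound hC0 fun h ↦ (ContinuousMap.norm_le _ (by positivity)).2 fun t ↦ ?_
    rw [hA_apply]
    calc _ ≤ ‖fderiv ℝ X (q t, y t)‖ * ‖((0 : E₁), h t)‖ * ‖p t‖ :=
          ((ContinuousLinearMap.le_opNorm _ _).trans
            (mul_le_mul_of_nonneg_right (ContinuousLinearMap.le_opNorm _ _) (norm_nonneg _)))
      _ = (‖fderiv ℝ X (q t, y t)‖ * ‖p t‖) * ‖h t‖ := by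
          rw [Prod.norm_mk, norm_zero, max_eq_right (norm_nonneg _)]; ring
      _ ≤ C * ‖h‖ := mul_le_mul (hC t t.2) (h.norm_coe_le_norm t) (norm_nonneg _) hC0
  let V := volterra (E := E₂) hab ⟨s, hs⟩
  have hVA : ‖V ∘L A‖ < 1 :=
    (V.opNorm_comp_le A).trans_lt
      ((mul_le_mul (norm_volterra_le hab _) hA (norm_nonneg A) (sub_nonneg.2 hab)).trans_lt hC')
  -- the derivative `1 - V A` of the integrated equation is invertible by the Neumann series
  let e : C(K, E₂) ≃L[ℝ] C(K, E₂) :=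
    ContinuousLinearEquiv.ofUnit (Units.oneSub (V ∘L A) hVA)
  have he : (e : C(K, E₂) →L[ℝ] C(K, E₂)) = 1 - V ∘L A := rfl
  let G : C(K, E₂) → C(K, E₂) := fun u ↦ u - V (f u)
  have hG : ContDiffAt ℝ ∞ G y' :=
    contDiffAt_id.sub (V.contDiff.contDiffAt.comp y' (hf.contDiffAt (hW.mem_nhds hy'W)))
  have hG' : HasFDerivAt G (e : C(K, E₂) →L[ℝ] C(K, E₂)) y' := by
    rw [he]
    exact (hasFDerivAt_id y').sub (V.hasFDerivAt.comp y' hfA)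
  have hGy : G y' = ContinuousMap.const _ (y s) := by
    refine (eq_const_add_volterra_iff hab ⟨s, hs⟩ y' (f y') (y s)).2 ⟨rfl, fun t ht ↦ ?_⟩
    rw [hf_apply y' hy'W]
    exact (hy t ht).congr (fun τ hτ ↦ IccExtend_of_mem hab _ hτ) (IccExtend_of_mem hab _ ht)
  -- the solution operator: the local inverse of `G`, applied to constant curves
  let cst : E₂ →L[ℝ] C(K, E₂) := ContinuousLinearMap.const ℝ K
  let R := hG.localInverse hG' (by simp)
  have hR : ContDiffAt ℝ ∞ R (G y') := hG.to_localInverse hG' (by simp)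
  have hRy : R (G y') = y' := (hG.hasStrictFDerivAt' hG' (by simp)).localInverse_apply_image
  have hGR : ∀ᶠ v in 𝓝 (G y'), G (R v) = v :=
    (hG.hasStrictFDerivAt' hG' (by simp)).eventually_right_inverse
  have hcst : cst (y s) = G y' := hGy.symm
  have hS : ContDiffAt ℝ ∞ (R ∘ cst) (y s) :=
    ContDiffAt.comp (y s) (hcst ▸ hR) cst.contDiff.contDiffAt
  have hSy : (R ∘ cst) (y s) = y' := by rw [Function.comp_apply, hcst, hRy]
  have hGS : ∀ᶠ z in 𝓝 (y s), G ((R ∘ cst) z) = cst z :=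
    cst.continuous.continuousAt.eventually (hcst ▸ hGR)
  have heval : ∀ t (ht : t ∈ K), (fun z ↦ IccExtend hab ((R ∘ cst) z) t) =
      (ContinuousMap.evalCLM ℝ (⟨t, ht⟩ : K)) ∘ (R ∘ cst) := fun t ht ↦ by
    ext z; rw [IccExtend_of_mem hab _ ht]; rfl
  have hD : ∀ h t (ht : t ∈ K), fderiv ℝ (fun z ↦ IccExtend hab ((R ∘ cst) z) t) (y s) h =
      fderiv ℝ (R ∘ cst) (y s) h ⟨t, ht⟩ := fun h t ht ↦ by
    have h₁ := (ContinuousMap.evalCLM ℝ (⟨t, ht⟩ : K)).hasFDerivAt.comp (y s)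
      (hS.differentiableAt (by simp)).hasFDerivAt
    rw [heval t ht, h₁.fderiv]
    rfl
  refine ⟨fun z ↦ IccExtend hab ((R ∘ cst) z), ?_, ?_, ?_, ?_⟩
  · have hmem : ∀ᶠ z in 𝓝 (y s), (R ∘ cst) z ∈ W :=
      hS.continuousAt.eventually_mem (hSy.symm ▸ hW.mem_nhds hy'W)
    filter_upwards [hmem, hGS] with z hz hz'
    obtain ⟨h₁, h₂⟩ := (eq_const_add_volterra_iff hab ⟨s, hs⟩ _ _ z).1 hz'
    refine ⟨by rw [IccExtend_of_mem hab _ hs]; exact h₁, fun t ht ↦ ?_⟩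
    have h₃ := h₂ t ht
    rw [hf_apply _ hz] at h₃
    rw [IccExtend_of_mem hab _ ht]
    exact ⟨hz ⟨t, ht⟩, h₃⟩
  · intro t ht
    simp only [hSy, IccExtend_of_mem hab _ ht]
    rfl
  · intro t ht
    rw [heval t ht]
    exact (ContinuousMap.evalCLM ℝ (⟨t, ht⟩ : K)).contDiff.contDiffAt.comp (y s) hS
  · intro h
    set j := fderiv ℝ (R ∘ cst) (y s) h with hj
    -- differentiating `G (R (cst z)) = cst z` gives the integrated variational equation
    have hlin : j - V (A j) = ContinuousMap.const _ h := by
      have h₁ : HasFDerivAt (G ∘ (R ∘ cst))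
          ((e : C(K, E₂) →L[ℝ] C(K, E₂)) ∘L fderiv ℝ (R ∘ cst) (y s)) (y s) :=
        HasFDerivAt.comp (y s) (hSy.symm ▸ hG') (hS.differentiableAt (by simp)).hasFDerivAt
      have h₂ : HasFDerivAt (G ∘ (R ∘ cst)) cst (y s) :=
        cst.hasFDerivAt.congr_of_eventuallyEq hGS
      have h₃ := DFunLike.congr_fun (h₁.unique h₂) h
      rw [he] at h₃
      exact h₃
    obtain ⟨h₁, h₂⟩ := (eq_const_add_volterra_iff hab ⟨s, hs⟩ _ _ h).1 hlin
    refine ⟨by rw [hD h s hs]; exact h₁, fun t ht ↦ ?_⟩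
    have h₃ := h₂ t ht
    rw [hA_apply] at h₃
    rw [hD h t ht]
    refine h₃.congr (fun τ hτ ↦ ?_) ?_
    · rw [hD h τ hτ, IccExtend_of_mem hab _ hτ]
    · rw [hD h t ht, IccExtend_of_mem hab _ ht]

end LocalFlow

/-! ### The horizontal lift and the conformal factor in a local model -/

section LocalModel

/-- The exterior derivative of a 1-form on a normed space, as a bilinear form. -/
def flatExtDeriv {E : Type*} [NormedAddCommGroup E] [NormedSpace ℝ E] (A : E → E →L[ℝ] ℝ) (x : E) :
    E →L[ℝ] E →L[ℝ] ℝ :=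
  fderiv ℝ A x - (fderiv ℝ A x).flip

theorem flatExtDeriv_apply {E : Type*} [NormedAddCommGroup E] [NormedSpace ℝ E]
    (A : E → E →L[ℝ] ℝ) (x u v : E) :
    flatExtDeriv A x u v = fderiv ℝ A x u v - fderiv ℝ A x v u := rfl

theorem contDiffOn_flip {E G : Type*} [NormedAddCommGroup E] [NormedSpace ℝ E]
    [NormedAddCommGroup G] [NormedSpace ℝ G] {U : Set G} {T : G → E →L[ℝ] E →L[ℝ] ℝ}
    (hT : ContDiffOn ℝ ∞ T U) : ContDiffOn ℝ ∞ (fun x ↦ (T x).flip) U := by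
  have h := LinearIsometryEquiv.contDiff (n := ∞) (𝕜 := ℝ) (E := E →L[ℝ] E →L[ℝ] ℝ)
    (F := E →L[ℝ] E →L[ℝ] ℝ) (ContinuousLinearMap.flipₗᵢ ℝ E E ℝ)
  exact h.comp_contDiffOn hT

theorem contDiffOn_flatExtDeriv {E : Type*} [NormedAddCommGroup E] [NormedSpace ℝ E] {U : Set E}
    (hU : IsOpen U) {A : E → E →L[ℝ] ℝ} (hA : ContDiffOn ℝ ∞ A U) :
    ContDiffOn ℝ ∞ (flatExtDeriv A) U := by
  have h := hA.fderiv_of_isOpen hU (m := ∞) (by simp)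
  exact h.sub (contDiffOn_flip h)

variable {E₁ E₂ : Type*} [NormedAddCommGroup E₁] [NormedSpace ℝ E₁]
  [NormedAddCommGroup E₂] [NormedSpace ℝ E₂]

/-- The 1-form `A` on the open subset `U` of `E₁ × E₂` is smooth, and restricts to a contact form on
each slice `{x₁} × E₂`. -/
structure IsFiberContactForm (A : E₁ × E₂ → E₁ × E₂ →L[ℝ] ℝ) (U : Set (E₁ × E₂)) : Prop where
  isOpen : IsOpen U
  contDiffOn : ContDiffOn ℝ ∞ A U
  exists_ne_zero : ∀ x ∈ U, ∃ w : E₂, A x (0, w) ≠ 0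
  nondegenerate : ∀ x ∈ U, ∀ w : E₂, A x (0, w) = 0 →
    (∀ w' : E₂, A x (0, w') = 0 → flatExtDeriv A x (0, w) (0, w') = 0) → w = 0

/-- The linear map `X` has as graph the annihilator, with respect to `dA` and inside `ker A`, of the
vertical vectors in `ker A`. -/
def IsHorizontalAt (A : E₁ × E₂ → E₁ × E₂ →L[ℝ] ℝ) (x : E₁ × E₂) (X : E₁ →L[ℝ] E₂) : Prop :=
  ∀ v, A x (v, X v) = 0 ∧ ∀ w : E₂, A x (0, w) = 0 → flatExtDeriv A x (v, X v) (0, w) = 0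

/-- The perpendicular contains no vertical vector other than `0`, so it is no larger than the
graph. -/
theorem IsFiberContactForm.eq_of_isHorizontalAt {A : E₁ × E₂ → E₁ × E₂ →L[ℝ] ℝ}
    {U : Set (E₁ × E₂)} (h : IsFiberContactForm A U) {x : E₁ × E₂} (hx : x ∈ U) {X : E₁ →L[ℝ] E₂}
    (hX : IsHorizontalAt A x X) {v : E₁} {w : E₂} (h₀ : A x (v, w) = 0)
    (h₁ : ∀ w' : E₂, A x (0, w') = 0 → flatExtDeriv A x (v, w) (0, w') = 0) : w = X v := by
  have key : ((0 : E₁), w - X v) = (v, w) - (v, X v) := by simp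
  refine sub_eq_zero.1 (h.nondegenerate x hx _ ?_ fun w' hw' ↦ ?_)
  · rw [key, map_sub, h₀, (hX v).1, sub_zero]
  · rw [key, map_sub, sub_apply, h₁ w' hw', (hX v).2 w' hw', sub_zero]

/-- The horizontal distribution of a fibrewise contact form is the graph of a smooth family of
linear maps, and the Reeb vectors of the slices form a smooth family. With `β` for the restriction of
`A` to a slice, the bilinear form `dβ + β ⊗ β` is nondegenerate; both families are obtained by
inverting it. -/
theorem IsFiberContactForm.exists_horizontal [FiniteDimensional ℝ E₂]
    {A : E₁ × E₂ → E₁ × E₂ →L[ℝ] ℝ} {U : Set (E₁ × E₂)} (h : IsFiberContactForm A U) :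
    ∃ (X : E₁ × E₂ → E₁ →L[ℝ] E₂) (R : E₁ × E₂ → E₂), ContDiffOn ℝ ∞ X U ∧ ContDiffOn ℝ ∞ R U ∧
      ∀ x ∈ U, IsHorizontalAt A x (X x) ∧ A x (0, R x) = 1 := by
  have : CompleteSpace E₂ := FiniteDimensional.complete ℝ E₂
  let inr := ContinuousLinearMap.inr ℝ E₁ E₂
  let inl := ContinuousLinearMap.inl ℝ E₁ E₂
  let B := flatExtDeriv A
  let β : E₁ × E₂ → E₂ →L[ℝ] ℝ := fun x ↦ A x ∘L inr
  let Bv : E₁ × E₂ → E₁ × E₂ →L[ℝ] E₂ →L[ℝ] ℝ := fun x ↦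
    ((ContinuousLinearMap.compL ℝ E₂ (E₁ × E₂) ℝ).flip inr) ∘L B x
  let L : E₁ × E₂ → E₂ →L[ℝ] E₂ →L[ℝ] ℝ := fun x ↦ Bv x ∘L inr + (β x).smulRight (β x)
  have hL_apply : ∀ x w w', L x w w' = B x (0, w) (0, w') + β x w * β x w' := fun x w w' ↦ by
    simp [L, Bv, inr]
  have hB : ContDiffOn ℝ ∞ B U := contDiffOn_flatExtDeriv h.isOpen h.contDiffOn
  have hβ : ContDiffOn ℝ ∞ β U := h.contDiffOn.clm_comp contDiffOn_const
  have hBv : ContDiffOn ℝ ∞ Bv U := contDiffOn_const.clm_comp hB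
  have hL : ContDiffOn ℝ ∞ L U := (hBv.clm_comp contDiffOn_const).add (hβ.smulRight hβ)
  have hself : ∀ x w, B x (0, w) (0, w) = 0 := fun x w ↦ sub_self _
  have hinj : ∀ x ∈ U, Function.Injective (L x) := fun x hx ↦ by
    refine (injective_iff_map_eq_zero (L x)).2 fun w hw ↦ ?_
    have h₀ : β x w = 0 := by
      have := DFunLike.congr_fun hw w
      rw [hL_apply, hself, zero_add] at this
      exact mul_self_eq_zero.1 this
    refine h.nondegenerate x hx w h₀ fun w' _ ↦ ?_
    have := DFunLike.congr_fun hw w'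
    rw [hL_apply, h₀, zero_mul, add_zero] at this
    exact this
  have hdim : Module.finrank ℝ E₂ = Module.finrank ℝ (E₂ →L[ℝ] ℝ) := by
    rw [← (LinearMap.toContinuousLinearMap : (E₂ →ₗ[ℝ] ℝ) ≃ₗ[ℝ] _).finrank_eq]
    exact (Subspace.dual_finrank_eq (K := ℝ) (V := E₂)).symm
  have hequiv : ∀ x ∈ U, ∃ e : E₂ ≃L[ℝ] (E₂ →L[ℝ] ℝ), (e : E₂ →L[ℝ] E₂ →L[ℝ] ℝ) = L x := by
    intro x hx
    refine ⟨(LinearEquiv.ofInjectiveOfFinrankEq (L x).toLinearMap (hinj x hx)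
      hdim).toContinuousLinearEquiv, ?_⟩
    ext w w'; rfl
  let Li : E₁ × E₂ → (E₂ →L[ℝ] ℝ) →L[ℝ] E₂ := fun x ↦ ContinuousLinearMap.inverse (L x)
  have hLi : ContDiffOn ℝ ∞ Li U := fun x hx ↦ by
    obtain ⟨e, he⟩ := hequiv x hx
    exact ContDiffAt.comp_contDiffWithinAt x (he ▸ contDiffAt_map_inverse e) (hL x hx)
  have hLLi : ∀ x ∈ U, ∀ ℓ, L x (Li x ℓ) = ℓ := fun x hx ℓ ↦ by
    obtain ⟨e, he⟩ := hequiv x hx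
    simp only [Li, ← he, ContinuousLinearMap.inverse_equiv]
    exact e.apply_symm_apply ℓ
  let R : E₁ × E₂ → E₂ := fun x ↦ Li x (β x)
  have hR : ContDiffOn ℝ ∞ R U := hLi.clm_apply hβ
  have hR1 : ∀ x ∈ U, β x (R x) = 1 ∧ ∀ w, B x (0, R x) (0, w) = 0 := fun x hx ↦ by
    have hLR : ∀ w, B x (0, R x) (0, w) + β x (R x) * β x w = β x w := fun w ↦ by
      rw [← hL_apply]; exact DFunLike.congr_fun (hLLi x hx (β x)) w
    have h₁ : β x (R x) = 1 := by
      have h₂ := hLR (R x)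
      rw [hself, zero_add] at h₂
      by_contra hne
      have h₀ : β x (R x) = 0 := by
        have : β x (R x) * (β x (R x) - 1) = 0 := by rw [mul_sub, h₂, mul_one, sub_self]
        exact (mul_eq_zero.1 this).resolve_right (sub_ne_zero.2 hne)
      have hR0 : R x = 0 := h.nondegenerate x hx _ h₀ fun w' hw' ↦ by
        have h₃ := hLR w'
        rw [h₀, zero_mul, add_zero] at h₃
        exact h₃.trans hw'
      obtain ⟨w, hw⟩ := h.exists_ne_zero x hx
      have h₃ := hLR w
      rw [hR0] at h₃
      have h₄ : ((0 : E₁), (0 : E₂)) = 0 := rfl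
      rw [h₄] at h₃
      simp only [map_zero, zero_apply, zero_mul, add_zero] at h₃
      exact hw h₃.symm
    refine ⟨h₁, fun w ↦ ?_⟩
    have h₂ := hLR w
    rw [h₁, one_mul] at h₂
    linarith
  -- the covector `w ↦ dA(u, w)` on the slice, corrected along the Reeb direction so that
  -- it vanishes exactly at the horizontal vectors `u`
  let N : E₁ × E₂ → E₁ × E₂ →L[ℝ] E₂ →L[ℝ] ℝ := fun x ↦
    Bv x + (A x - (B x).flip (inr (R x))).smulRight (β x)
  have hN_apply : ∀ x u w,
      N x u w = B x u (0, w) + (A x u - B x u (0, R x)) * β x w := fun x u w ↦ by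
    simp [N, Bv, inr]
  have hflip : ContDiffOn ℝ ∞ (fun x ↦ (B x).flip) U := contDiffOn_flip hB
  have hN : ContDiffOn ℝ ∞ N U :=
    hBv.add ((h.contDiffOn.sub (hflip.clm_apply (contDiffOn_const.clm_apply hR))).smulRight hβ)
  have hNL : ∀ x ∈ U, ∀ w, N x (0, w) = L x w := fun x hx w ↦ by
    ext w'
    have h₀ : B x (0, w) (0, R x) = 0 := by
      have h₁ : B x (0, w) (0, R x) = - B x (0, R x) (0, w) := by
        simp only [B, flatExtDeriv_apply]; ring
      rw [h₁, (hR1 x hx).2, neg_zero]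
    rw [hN_apply, hL_apply, h₀, sub_zero]
    rfl
  let X : E₁ × E₂ → E₁ →L[ℝ] E₂ := fun x ↦ -(Li x ∘L N x ∘L inl)
  have hX : ContDiffOn ℝ ∞ X U := (hLi.clm_comp (hN.clm_comp contDiffOn_const)).neg
  refine ⟨X, R, hX, hR, fun x hx ↦ ⟨fun v ↦ ?_, (hR1 x hx).1⟩⟩
  have hNX : N x (v, X x v) = 0 := by
    have h₁ : (v, X x v) = (v, (0 : E₂)) + ((0 : E₁), X x v) := by simp
    rw [h₁, map_add, hNL x hx]
    simp only [X, neg_apply, ContinuousLinearMap.comp_apply, map_neg,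
      hLLi x hx, inl, ContinuousLinearMap.inl_apply, add_neg_cancel]
  have hNX' := fun w ↦ (hN_apply x (v, X x v) w).symm.trans (DFunLike.congr_fun hNX w)
  constructor
  · have h₁ := hNX' (R x)
    rw [(hR1 x hx).1] at h₁
    simp only [mul_one, zero_apply] at h₁
    linarith
  · intro w hw
    have h₁ := hNX' w
    have h₂ : β x w = 0 := hw
    rw [h₂, mul_zero, add_zero] at h₁
    exact h₁

/-- Infinitesimal parallel transport rescales the restriction of `A` to the slices by a positive
factor: by Cartan's formula the derivative of `A (0, j)` along the curve is `dA((p, y'), (0, j))`,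
which vanishes on `ker A` and therefore is a multiple of `A (0, j)`. -/
theorem IsFiberContactForm.exists_pos_scaling {A : E₁ × E₂ → E₁ × E₂ →L[ℝ] ℝ} {U : Set (E₁ × E₂)}
    (h : IsFiberContactForm A U) {X : E₁ × E₂ → E₁ →L[ℝ] E₂} {R : E₁ × E₂ → E₂}
    (hX : ContDiffOn ℝ ∞ X U) (hR : ContDiffOn ℝ ∞ R U)
    (hXR : ∀ x ∈ U, IsHorizontalAt A x (X x) ∧ A x (0, R x) = 1)
    {a b : ℝ} (hab : a ≤ b) {q p : ℝ → E₁} {y : ℝ → E₂} (hp : ContinuousOn p (Icc a b))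
    (hq : ∀ t ∈ Icc a b, HasDerivWithinAt q (p t) (Icc a b) t)
    (hyU : ∀ t ∈ Icc a b, (q t, y t) ∈ U)
    (hy : ∀ t ∈ Icc a b, HasDerivWithinAt y (X (q t, y t) (p t)) (Icc a b) t)
    {s t : ℝ} (hs : s ∈ Icc a b) (ht : t ∈ Icc a b) :
    ∃ g : ℝ, 0 < g ∧ ∀ j : ℝ → E₂, (∀ τ ∈ Icc a b,
      HasDerivWithinAt j (fderiv ℝ X (q τ, y τ) (0, j τ) (p τ)) (Icc a b) τ) →
      A (q t, y t) (0, j t) = g * A (q s, y s) (0, j s) := by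
  let x : ℝ → E₁ × E₂ := fun τ ↦ (q τ, y τ)
  have hx : ∀ τ ∈ Icc a b, HasDerivWithinAt x (p τ, X (x τ) (p τ)) (Icc a b) τ :=
    fun τ hτ ↦ (hq τ hτ).prodMk (hy τ hτ)
  have hxc : ContinuousOn x (Icc a b) := fun τ hτ ↦ (hx τ hτ).continuousWithinAt
  let μ : ℝ → ℝ := fun τ ↦ flatExtDeriv A (x τ) (p τ, X (x τ) (p τ)) (0, R (x τ))
  have hμ : ContinuousOn μ (Icc a b) := by
    have h₁ := (contDiffOn_flatExtDeriv h.isOpen h.contDiffOn).continuousOn.comp hxc hyU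
    have h₂ := (hX.continuousOn.comp hxc hyU).clm_apply hp
    have h₃ := hR.continuousOn.comp hxc hyU
    exact (h₁.clm_apply (hp.prodMk h₂)).clm_apply (continuousOn_const.prodMk h₃)
  -- `m τ = ∫_s^τ μ`
  let m : ℝ → ℝ := IccExtend hab (volterra hab ⟨s, hs⟩ ⟨(Icc a b).domRestrict μ, hμ.domRestrict⟩)
  have hm : ∀ τ ∈ Icc a b, HasDerivWithinAt m (μ τ) (Icc a b) τ := fun τ hτ ↦
    hasDerivWithinAt_volterra hab ⟨s, hs⟩ ⟨(Icc a b).domRestrict μ, hμ.domRestrict⟩ hτ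
  have hms : m s = 0 := by
    simp only [m]
    rw [IccExtend_of_mem hab _ hs, volterra_self]
  refine ⟨Real.exp (m t), Real.exp_pos _, fun j hj ↦ ?_⟩
  have hA : ∀ τ ∈ Icc a b, HasDerivWithinAt (fun τ ↦ A (x τ) (0, j τ))
      (μ τ * A (x τ) (0, j τ)) (Icc a b) τ := by
    intro τ hτ
    have hU := h.isOpen.mem_nhds (hyU τ hτ)
    have dA : HasFDerivAt A (fderiv ℝ A (x τ)) (x τ) :=
      ((h.contDiffOn.contDiffAt hU).differentiableAt (by simp)).hasFDerivAt
    have dX : HasFDerivAt X (fderiv ℝ X (x τ)) (x τ) :=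
      ((hX.contDiffAt hU).differentiableAt (by simp)).hasFDerivAt
    have h₁ := (dA.comp_hasDerivWithinAt τ (hx τ hτ)).clm_apply
      ((hasDerivWithinAt_const τ (Icc a b) (0 : E₁)).prodMk (hj τ hτ))
    -- differentiate `A (v, X v) = 0` in the direction of the slice
    have h₂ : fderiv ℝ A (x τ) (0, j τ) (p τ, X (x τ) (p τ)) +
        A (x τ) (0, fderiv ℝ X (x τ) (0, j τ) (p τ)) = 0 := by
      have e₁ : HasFDerivAt (fun z ↦ A z (p τ, X z (p τ))) _ (x τ) :=
        dA.clm_apply ((hasFDerivAt_const (p τ) (x τ)).prodMk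
          (dX.clm_apply (hasFDerivAt_const (p τ) (x τ))))
      have e₂ : HasFDerivAt (fun z ↦ A z (p τ, X z (p τ))) (0 : E₁ × E₂ →L[ℝ] ℝ) (x τ) :=
        (hasFDerivAt_const (0 : ℝ) (x τ)).congr_of_eventuallyEq
          (Filter.eventually_of_mem hU fun z hz ↦ ((hXR z hz).1 (p τ)).1)
      have := DFunLike.congr_fun (e₁.unique e₂) (0, j τ)
      simp at this
      linarith
    refine h₁.congr_deriv ?_
    -- split `j` into its Reeb component and a vector of `ker A`
    have h₃ : flatExtDeriv A (x τ) (p τ, X (x τ) (p τ)) (0, j τ) = μ τ * A (x τ) (0, j τ) := by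
      have hx' := hXR (x τ) (hyU τ hτ)
      have e₁ : ((0 : E₁), j τ) = (0, j τ - A (x τ) (0, j τ) • R (x τ)) +
          A (x τ) (0, j τ) • ((0 : E₁), R (x τ)) := by simp
      have e₂ : A (x τ) (0, j τ - A (x τ) (0, j τ) • R (x τ)) = 0 := by
        have e₃ : ((0 : E₁), j τ - A (x τ) (0, j τ) • R (x τ)) =
          (0, j τ) - A (x τ) (0, j τ) • ((0 : E₁), R (x τ)) := by simp
        rw [e₃, map_sub, map_smul, hx'.2, smul_eq_mul, mul_one, sub_self]
      have e₄ := (hx'.1 (p τ)).2 _ e₂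
      conv_lhs => rw [e₁]
      rw [map_add, e₄, map_smul, zero_add, smul_eq_mul, mul_comm]
    rw [← h₃, flatExtDeriv_apply]
    change _ + A (x τ) (0, fderiv ℝ X (x τ) (0, j τ) (p τ)) = _
    linarith
  have hconst : ∀ τ ∈ Icc a b, HasDerivWithinAt
      (fun τ ↦ Real.exp (-m τ) * A (x τ) (0, j τ)) 0 (Icc a b) τ := fun τ hτ ↦
    (((hm τ hτ).neg.exp).mul (hA τ hτ)).congr_deriv (by simp only [Pi.neg_apply]; ring)
  have := (convex_Icc a b).norm_image_sub_le_of_norm_hasDerivWithin_le (C := 0) hconst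
    (by simp) hs ht
  rw [zero_mul, norm_le_zero_iff, sub_eq_zero, hms, neg_zero, Real.exp_zero, one_mul] at this
  rw [← this, ← mul_assoc, ← Real.exp_add, add_neg_cancel, Real.exp_zero, one_mul]

end LocalModel

/-! ### 1-forms on manifolds in coordinates -/

section FormsOnManifolds

variable {E E' : Type*} [NormedAddCommGroup E] [NormedSpace ℝ E]
  [NormedAddCommGroup E'] [NormedSpace ℝ E']
  {M N : Type*} [TopologicalSpace M] [ChartedSpace E M] [TopologicalSpace N] [ChartedSpace E' N]

/-- The pullback of a 1-form on `M` under a map from a normed space. -/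
def formInCoord (α : ∀ m : M, TangentSpace 𝓘(ℝ, E) m →L[ℝ] ℝ) (ψ : E' → M) (x : E') :
    E' →L[ℝ] ℝ :=
  (α (ψ x)).comp (mfderiv 𝓘(ℝ, E') 𝓘(ℝ, E) ψ x)

theorem formInCoord_apply (α : ∀ m : M, TangentSpace 𝓘(ℝ, E) m →L[ℝ] ℝ) (ψ : E' → M) (x v : E') :
    formInCoord α ψ x v = α (ψ x) (mfderiv 𝓘(ℝ, E') 𝓘(ℝ, E) ψ x v) := rfl

/-- The pullback of a 1-form under a map of manifolds. -/
def pullbackForm (α : ∀ m : M, TangentSpace 𝓘(ℝ, E) m →L[ℝ] ℝ) (ι : N → M) (n : N) :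
    TangentSpace 𝓘(ℝ, E') n →L[ℝ] ℝ :=
  (α (ι n)).comp (mfderiv 𝓘(ℝ, E') 𝓘(ℝ, E) ι n)

variable [IsManifold 𝓘(ℝ, E) ∞ M]

theorem IsSmoothOneForm.pullbackForm [IsManifold 𝓘(ℝ, E') ∞ N]
    {α : ∀ m : M, TangentSpace 𝓘(ℝ, E) m →L[ℝ] ℝ}
    (hα : IsSmoothOneForm α) {ι : N → M} (hι : ContMDiff 𝓘(ℝ, E') 𝓘(ℝ, E) ∞ ι) :
    IsSmoothOneForm (ContactBundle.pullbackForm (E' := E') α ι) :=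
  ContMDiff.comp hα (hι.contMDiff_tangentMap (by simp))

theorem IsSmoothOneForm.contDiffOn_formInCoord [FiniteDimensional ℝ E']
    {α : ∀ m : M, TangentSpace 𝓘(ℝ, E) m →L[ℝ] ℝ} (hα : IsSmoothOneForm α) {ψ : E' → M}
    {U : Set E'} (hU : IsOpen U) (hψ : ContMDiffOn 𝓘(ℝ, E') 𝓘(ℝ, E) ∞ ψ U) :
    ContDiffOn ℝ ∞ (formInCoord α ψ) U := by
  refine contDiffOn_clm_apply.2 fun v ↦ contMDiffOn_iff_contDiffOn.1 ?_
  have h₁ := hψ.contMDiffOn_tangentMapWithin (m := ∞) (by simp) hU.uniqueMDiffOn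
  have h₂ : ContMDiffOn 𝓘(ℝ, E') 𝓘(ℝ, E').tangent ∞
      (fun x ↦ (⟨x, v⟩ : TangentBundle 𝓘(ℝ, E') E')) U :=
    contMDiffOn_vectorSpace_iff_contDiffOn.2 contDiffOn_const
  refine (ContMDiff.comp_contMDiffOn hα (h₁.comp h₂ fun x hx ↦ hx)).congr fun x hx ↦ ?_
  rw [formInCoord_apply, ← mfderivWithin_of_isOpen hU hx]
  rfl

theorem mdifferentiableAt_extChartAt_symm' {m : M} {x : E}
    (hx : x ∈ (extChartAt 𝓘(ℝ, E) m).target) :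
    MDifferentiableAt 𝓘(ℝ, E) 𝓘(ℝ, E) (extChartAt 𝓘(ℝ, E) m).symm x :=
  ((contMDiffOn_extChartAt_symm (n := ∞) m).contMDiffAt
    ((isOpen_extChartAt_target m).mem_nhds hx)).mdifferentiableAt (by simp)

theorem mdifferentiableAt_extChartAt' {m m' : M} (hm : m' ∈ (extChartAt 𝓘(ℝ, E) m).source) :
    MDifferentiableAt 𝓘(ℝ, E) 𝓘(ℝ, E) (extChartAt 𝓘(ℝ, E) m) m' :=
  (contMDiffAt_extChartAt' (n := ∞) (by rwa [extChartAt_source] at hm)).mdifferentiableAt (by simp)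

theorem mfderiv_extChartAt_symm_mfderiv_extChartAt (m : M) (u : TangentSpace 𝓘(ℝ, E) m) :
    mfderiv 𝓘(ℝ, E) 𝓘(ℝ, E) (extChartAt 𝓘(ℝ, E) m).symm (extChartAt 𝓘(ℝ, E) m m)
      (mfderiv 𝓘(ℝ, E) 𝓘(ℝ, E) (extChartAt 𝓘(ℝ, E) m) m u) = u := by
  have h := mfderiv_comp m
    (mdifferentiableAt_extChartAt_symm' (mem_extChartAt_target m))
    (mdifferentiableAt_extChartAt' (mem_extChartAt_source (I := 𝓘(ℝ, E)) m))
  have h' : (extChartAt 𝓘(ℝ, E) m).symm ∘ (extChartAt 𝓘(ℝ, E) m) =ᶠ[𝓝 m] id :=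
    Filter.eventually_of_mem (extChartAt_source_mem_nhds m)
      fun y hy ↦ (extChartAt 𝓘(ℝ, E) m).left_inv hy
  rw [h'.mfderiv_eq, mfderiv_id] at h
  exact (DFunLike.congr_fun h u).symm

theorem oneFormInChart_mfderiv (α : ∀ m : M, TangentSpace 𝓘(ℝ, E) m →L[ℝ] ℝ) (m : M)
    (u : TangentSpace 𝓘(ℝ, E) m) :
    oneFormInChart α m (extChartAt 𝓘(ℝ, E) m m)
      (mfderiv 𝓘(ℝ, E) 𝓘(ℝ, E) (extChartAt 𝓘(ℝ, E) m) m u) = α m u := by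
  -- `φ.symm (φ m)` equals `m` only propositionally, so `α` is moved along this equality
  have h : ∀ m', m' = m → ∀ T : E →L[ℝ] E, α m' (T (mfderiv 𝓘(ℝ, E) 𝓘(ℝ, E)
      (extChartAt 𝓘(ℝ, E) m) m u)) = α m (T (mfderiv 𝓘(ℝ, E) 𝓘(ℝ, E)
      (extChartAt 𝓘(ℝ, E) m) m u)) := by rintro _ rfl T; rfl
  exact (h _ (extChartAt_to_inv m) _).trans
    (congrArg (α m) (mfderiv_extChartAt_symm_mfderiv_extChartAt m u))

theorem extDerivOneForm_eq (α : ∀ m : M, TangentSpace 𝓘(ℝ, E) m →L[ℝ] ℝ) (m : M)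
    (u v : TangentSpace 𝓘(ℝ, E) m) :
    extDerivOneForm α m u v = flatExtDeriv (oneFormInChart α m) (extChartAt 𝓘(ℝ, E) m m)
      (mfderiv 𝓘(ℝ, E) 𝓘(ℝ, E) (extChartAt 𝓘(ℝ, E) m) m u)
      (mfderiv 𝓘(ℝ, E) 𝓘(ℝ, E) (extChartAt 𝓘(ℝ, E) m) m v) := rfl

theorem IsSmoothOneForm.contDiffOn_oneFormInChart [FiniteDimensional ℝ E]
    {α : ∀ m : M, TangentSpace 𝓘(ℝ, E) m →L[ℝ] ℝ} (hα : IsSmoothOneForm α) (m : M) :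
    ContDiffOn ℝ ∞ (oneFormInChart α m) (extChartAt 𝓘(ℝ, E) m).target :=
  hα.contDiffOn_formInCoord (isOpen_extChartAt_target m) (contMDiffOn_extChartAt_symm m)

/-- The exterior derivative of a 1-form on a normed space commutes with pullback. -/
theorem flatExtDeriv_pullback {A : E → E →L[ℝ] ℝ} {B : E' → E' →L[ℝ] ℝ} {τ : E' → E} {x : E'}
    (hA : DifferentiableAt ℝ A (τ x)) (hτ : ContDiffAt ℝ ∞ τ x)
    (hB : B =ᶠ[𝓝 x] fun y ↦ (A (τ y)).comp (fderiv ℝ τ y)) (u v : E') :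
    flatExtDeriv B x u v = flatExtDeriv A (τ x) (fderiv ℝ τ x u) (fderiv ℝ τ x v) := by
  have h₁ : HasFDerivAt τ (fderiv ℝ τ x) x := (hτ.differentiableAt (by simp)).hasFDerivAt
  have h₂ : HasFDerivAt (fderiv ℝ τ) (fderiv ℝ (fderiv ℝ τ) x) x :=
    ((hτ.fderiv_right (m := ∞) (by simp)).differentiableAt (by simp)).hasFDerivAt
  have h₃ := ((hA.hasFDerivAt.comp x h₁).clm_comp h₂).congr_of_eventuallyEq hB
  have hsymm := (hτ.isSymmSndFDerivAt (by
    rw [minSmoothness_of_isRCLikeNormedField]; exact WithTop.coe_le_coe.2 le_top)).eq u v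
  rw [flatExtDeriv_apply, flatExtDeriv_apply, h₃.fderiv]
  simp [hsymm]

/-- The exterior derivative, computed in the preferred chart, can be computed after pullback to
any parametrization by a normed space. -/
theorem IsSmoothOneForm.flatExtDeriv_formInCoord [FiniteDimensional ℝ E]
    {α : ∀ m : M, TangentSpace 𝓘(ℝ, E) m →L[ℝ] ℝ} (hα : IsSmoothOneForm α) {ψ : E' → M}
    {U : Set E'} (hU : IsOpen U) (hψ : ContMDiffOn 𝓘(ℝ, E') 𝓘(ℝ, E) ∞ ψ U) {x : E'} (hx : x ∈ U)
    (u v : E') :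
    flatExtDeriv (formInCoord α ψ) x u v = extDerivOneForm α (ψ x)
      (mfderiv 𝓘(ℝ, E') 𝓘(ℝ, E) ψ x u) (mfderiv 𝓘(ℝ, E') 𝓘(ℝ, E) ψ x v) := by
  have hψx : ContMDiffAt 𝓘(ℝ, E') 𝓘(ℝ, E) ∞ ψ x := hψ.contMDiffAt (hU.mem_nhds hx)
  set φ := extChartAt 𝓘(ℝ, E) (ψ x) with hφ
  -- compare `ψ` with the preferred chart through the transition map `τ`
  let τ : E' → E := φ ∘ ψ
  have hτ : ContDiffAt ℝ ∞ τ x :=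
    contMDiffAt_iff_contDiffAt.1 (ContMDiffAt.comp x contMDiffAt_extChartAt hψx)
  have hev : ∀ᶠ y in 𝓝 x, y ∈ U ∧ ψ y ∈ φ.source :=
    (hU.eventually_mem hx).and
      (hψx.continuousAt.eventually_mem (extChartAt_source_mem_nhds (I := 𝓘(ℝ, E)) (ψ x)))
  have hdτ : ∀ y, y ∈ U → ψ y ∈ φ.source → ∀ w, fderiv ℝ τ y w =
      mfderiv 𝓘(ℝ, E) 𝓘(ℝ, E) φ (ψ y) (mfderiv 𝓘(ℝ, E') 𝓘(ℝ, E) ψ y w) := fun y hy hy' w ↦ by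
    rw [← mfderiv_eq_fderiv]
    exact DFunLike.congr_fun (mfderiv_comp y (mdifferentiableAt_extChartAt' hy')
      ((hψ.contMDiffAt (hU.mem_nhds hy)).mdifferentiableAt (by simp))) w
  have hB : formInCoord α ψ =ᶠ[𝓝 x] fun y ↦ (oneFormInChart α (ψ x) (τ y)).comp (fderiv ℝ τ y) := by
    filter_upwards [hev, hev.eventually_nhds] with y hy hy'
    have hτy : τ y ∈ φ.target := φ.map_source hy.2
    have h₁ : ψ =ᶠ[𝓝 y] φ.symm ∘ τ := by
      filter_upwards [hy'] with z hz using (φ.left_inv hz.2).symm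
    have hτd : MDifferentiableAt 𝓘(ℝ, E') 𝓘(ℝ, E) τ y :=
      MDifferentiableAt.comp y (mdifferentiableAt_extChartAt' hy.2)
        ((hψ.contMDiffAt (hU.mem_nhds hy.1)).mdifferentiableAt (by simp))
    have h₂ : formInCoord α ψ y = formInCoord α (φ.symm ∘ τ) y := by
      have e : ψ y = (φ.symm ∘ τ) y := h₁.eq_of_nhds
      have h₃ : ∀ m', m' = ψ y → ∀ T : E' →L[ℝ] E, (α m').comp T = (α (ψ y)).comp T := by
        rintro _ rfl T; rfl
      unfold formInCoord
      rw [h₁.mfderiv_eq]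
      exact (h₃ _ e.symm _).symm
    rw [h₂]
    ext w
    have h₄ := mfderiv_comp y (mdifferentiableAt_extChartAt_symm' hτy) hτd
    rw [mfderiv_eq_fderiv (f := τ)] at h₄
    exact congrArg (α (φ.symm (τ y))) (DFunLike.congr_fun h₄ w)
  have hA : DifferentiableAt ℝ (oneFormInChart α (ψ x)) (τ x) :=
    ((hα.contDiffOn_oneFormInChart (ψ x)).contDiffAt
      ((isOpen_extChartAt_target _).mem_nhds (mem_extChartAt_target _))).differentiableAt (by simp)
  rw [flatExtDeriv_pullback hA hτ hB, hdτ x hx (mem_extChartAt_source _),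
    hdτ x hx (mem_extChartAt_source _)]
  rfl

/-- The exterior derivative commutes with pullback. -/
theorem IsSmoothOneForm.extDerivOneForm_pullbackForm [FiniteDimensional ℝ E]
    [IsManifold 𝓘(ℝ, E') ∞ N] {α : ∀ m : M, TangentSpace 𝓘(ℝ, E) m →L[ℝ] ℝ}
    (hα : IsSmoothOneForm α) {ι : N → M} (hι : ContMDiff 𝓘(ℝ, E') 𝓘(ℝ, E) ∞ ι) (n : N)
    (u v : TangentSpace 𝓘(ℝ, E') n) :
    extDerivOneForm (ContactBundle.pullbackForm α ι) n u v =
      extDerivOneForm α (ι n) (mfderiv 𝓘(ℝ, E') 𝓘(ℝ, E) ι n u)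
        (mfderiv 𝓘(ℝ, E') 𝓘(ℝ, E) ι n v) := by
  set φ := extChartAt 𝓘(ℝ, E') n with hφ
  have hψ : ContMDiffOn 𝓘(ℝ, E') 𝓘(ℝ, E) ∞ (ι ∘ φ.symm) φ.target :=
    hι.comp_contMDiffOn (contMDiffOn_extChartAt_symm n)
  have hd : ∀ y ∈ φ.target, mfderiv 𝓘(ℝ, E') 𝓘(ℝ, E) (ι ∘ φ.symm) y =
      (mfderiv 𝓘(ℝ, E') 𝓘(ℝ, E) ι (φ.symm y)).comp (mfderiv 𝓘(ℝ, E') 𝓘(ℝ, E') φ.symm y) :=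
    fun y hy ↦ mfderiv_comp y ((hι _).mdifferentiableAt (by simp))
      (mdifferentiableAt_extChartAt_symm' hy)
  have hopen := isOpen_extChartAt_target (I := 𝓘(ℝ, E')) n
  have hmem := mem_extChartAt_target (I := 𝓘(ℝ, E')) n
  have hform : oneFormInChart (ContactBundle.pullbackForm α ι) n =ᶠ[𝓝 (φ n)]
      formInCoord α (ι ∘ φ.symm) := by
    filter_upwards [hopen.mem_nhds hmem] with y hy
    ext w
    rw [formInCoord_apply, hd y hy]
    rfl
  have hflat : flatExtDeriv (oneFormInChart (ContactBundle.pullbackForm α ι) n) (φ n) =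
      flatExtDeriv (formInCoord α (ι ∘ φ.symm)) (φ n) := by
    unfold flatExtDeriv
    rw [hform.fderiv_eq]
  refine (DFunLike.congr_fun (DFunLike.congr_fun hflat _) _).trans
    ((hα.flatExtDeriv_formInCoord hopen hψ hmem _ _).trans ?_)
  rw [hd _ hmem]
  have key : ∀ w : TangentSpace 𝓘(ℝ, E') n, mfderiv 𝓘(ℝ, E') 𝓘(ℝ, E') φ.symm (φ n)
      (mfderiv 𝓘(ℝ, E') 𝓘(ℝ, E') φ n w) = w := mfderiv_extChartAt_symm_mfderiv_extChartAt n
  have e : φ.symm (φ n) = n := extChartAt_to_inv n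
  have h : ∀ n', n' = n → ∀ u' v' : E', u' = u → v' = v →
      extDerivOneForm α (ι n') (mfderiv 𝓘(ℝ, E') 𝓘(ℝ, E) ι n' u')
        (mfderiv 𝓘(ℝ, E') 𝓘(ℝ, E) ι n' v') =
      extDerivOneForm α (ι n) (mfderiv 𝓘(ℝ, E') 𝓘(ℝ, E) ι n u)
        (mfderiv 𝓘(ℝ, E') 𝓘(ℝ, E) ι n v) := by
    rintro _ rfl _ _ rfl rfl; rfl
  exact h _ e _ _ (key u) (key v)

/-- Two 1-forms with the same kernel have proportional exterior derivatives on that kernel: if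
`α' = g α` then `dα' = g dα + dg ∧ α`. -/
theorem CoorientedField.IsKernelForm.exists_extDerivOneForm_eq [FiniteDimensional ℝ E]
    {ξ : CoorientedField E M} {α α' : ∀ m : M, TangentSpace 𝓘(ℝ, E) m →L[ℝ] ℝ}
    (hα : ξ.IsKernelForm α) (hα' : ξ.IsKernelForm α') {m : M} (h0 : α m ≠ 0) :
    ∃ g : ℝ, g ≠ 0 ∧ ∀ u ∈ ξ.plane m, ∀ v ∈ ξ.plane m,
      extDerivOneForm α' m u v = g * extDerivOneForm α m u v := by
  set φ := extChartAt 𝓘(ℝ, E) m with hφ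
  let A := oneFormInChart α m
  let A' := oneFormInChart α' m
  have hnhds := (isOpen_extChartAt_target (I := 𝓘(ℝ, E)) m).mem_nhds (mem_extChartAt_target m)
  have hA : HasFDerivAt A (fderiv ℝ A (φ m)) (φ m) :=
    (((hα.1.contDiffOn_oneFormInChart m).contDiffAt hnhds).differentiableAt (by simp)).hasFDerivAt
  have hA' : HasFDerivAt A' (fderiv ℝ A' (φ m)) (φ m) :=
    (((hα'.1.contDiffOn_oneFormInChart m).contDiffAt hnhds).differentiableAt (by simp)).hasFDerivAt
  have hker : ∀ y w, A y w = 0 ↔ A' y w = 0 := fun y w ↦ by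
    have h₁ := (hα.2 (φ.symm y)).symm.trans (hα'.2 (φ.symm y))
    have h₂ := SetLike.ext_iff.1 h₁ (mfderiv 𝓘(ℝ, E) 𝓘(ℝ, E) φ.symm y w)
    exact h₂
  obtain ⟨e₀, he₀⟩ : ∃ e, α m e ≠ 0 := by
    by_contra! h
    exact h0 (ContinuousLinearMap.ext h)
  let e : E := mfderiv 𝓘(ℝ, E) 𝓘(ℝ, E) φ m e₀
  have he : A (φ m) e ≠ 0 := by
    have := oneFormInChart_mfderiv α m e₀
    exact fun h ↦ he₀ (this.symm.trans h)
  -- near `φ m` the factor is the quotient of the values on the fixed vector `e`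
  let g : E → ℝ := fun y ↦ A' y e * (A y e)⁻¹
  have hAe : HasFDerivAt (fun y ↦ A y e) ((fderiv ℝ A (φ m)).flip e) (φ m) :=
    (hA.clm_apply (hasFDerivAt_const e _)).congr_fderiv (by ext; simp)
  have hAe' : HasFDerivAt (fun y ↦ A' y e) ((fderiv ℝ A' (φ m)).flip e) (φ m) :=
    (hA'.clm_apply (hasFDerivAt_const e _)).congr_fderiv (by ext; simp)
  have hg : DifferentiableAt ℝ g (φ m) :=
    hAe'.differentiableAt.fun_mul (hAe.differentiableAt.fun_inv he)
  have hAA' : A' =ᶠ[𝓝 (φ m)] fun y ↦ g y • A y := by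
    filter_upwards [hAe.continuousAt.eventually_ne he] with y hy
    ext w
    have h₁ : A y (w - (A y w / A y e) • e) = 0 := by
      rw [map_sub, map_smul, smul_eq_mul, div_mul_cancel₀ _ hy, sub_self]
    rw [hker, map_sub, map_smul, smul_eq_mul, sub_eq_zero] at h₁
    rw [h₁, smul_apply, smul_eq_mul]
    simp only [g]
    ring
  have hder := ((hg.hasFDerivAt.smul hA).congr_of_eventuallyEq hAA').fderiv
  refine ⟨g (φ m), mul_ne_zero (fun h ↦ he ((hker _ _).2 h)) (inv_ne_zero he), fun u hu v hv ↦ ?_⟩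
  have hz : ∀ w ∈ ξ.plane m, A (φ m) (mfderiv 𝓘(ℝ, E) 𝓘(ℝ, E) φ m w) = 0 := fun w hw ↦ by
    rw [hα.2 m] at hw
    exact (oneFormInChart_mfderiv α m w).trans hw
  have hflat : ∀ x y : E, A (φ m) x = 0 → A (φ m) y = 0 →
      flatExtDeriv A' (φ m) x y = g (φ m) * flatExtDeriv A (φ m) x y := fun x y hx hy ↦ by
    rw [flatExtDeriv_apply, flatExtDeriv_apply, hder]
    simp only [add_apply, smul_apply, ContinuousLinearMap.smulRight_apply, smul_eq_mul, hx, hy,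
      mul_zero, add_zero]
    exact (mul_sub _ _ _).symm
  exact hflat _ _ (hz u hu) (hz v hv)

end FormsOnManifolds

/-! ### Smooth trivializations -/

section Trivializations

variable {EM EB EF : Type*} [NormedAddCommGroup EM] [NormedSpace ℝ EM]
  [NormedAddCommGroup EB] [NormedSpace ℝ EB] [NormedAddCommGroup EF] [NormedSpace ℝ EF]
  {M B F : Type*} [TopologicalSpace M] [ChartedSpace EM M] [TopologicalSpace B] [ChartedSpace EB B]
  [TopologicalSpace F] [ChartedSpace EF F] {π : M → B}

namespace SmoothTrivialization

variable (e : SmoothTrivialization EM EB EF F π) {b : B}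

theorem mk_mem_target (hb : b ∈ e.baseSet) (f : F) : (b, f) ∈ e.target :=
  e.toTrivialization.mem_target.2 hb

theorem proj_param (hb : b ∈ e.baseSet) (f : F) : π (e.param b f) = b :=
  e.toTrivialization.proj_symm_apply (e.mk_mem_target hb f)

theorem coord_param (hb : b ∈ e.baseSet) (f : F) : e.coord (e.param b f) = f :=
  congrArg Prod.snd (e.toOpenPartialHomeomorph.right_inv (e.mk_mem_target hb f))

theorem param_proj_coord {m : M} (hm : π m ∈ e.baseSet) : e.param (π m) (e.coord m) = m := by
  have h := e.toTrivialization.mem_source.2 hm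
  have h₁ : (π m, e.coord m) = e.toOpenPartialHomeomorph m :=
    Prod.ext (e.toTrivialization.coe_fst h).symm rfl
  unfold param
  rw [h₁]
  exact e.toOpenPartialHomeomorph.left_inv h

theorem contMDiff_param (hb : b ∈ e.baseSet) : ContMDiff 𝓘(ℝ, EF) 𝓘(ℝ, EM) ∞ (e.param b) :=
  contMDiffOn_univ.1 (e.contMDiffOn_invFun.comp
    (contMDiff_const.prodMk contMDiff_id).contMDiffOn fun f _ ↦ e.mk_mem_target hb f)

theorem isOpen_preimage_baseSet : IsOpen (π ⁻¹' e.baseSet) := by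
  rw [← e.source_eq]; exact e.open_source

theorem contMDiffAt_coord {m : M} (hm : π m ∈ e.baseSet) :
    ContMDiffAt 𝓘(ℝ, EM) 𝓘(ℝ, EF) ∞ e.coord m :=
  contMDiff_snd.contMDiffAt.comp m (e.contMDiffOn_toFun.contMDiffAt
    (e.open_source.mem_nhds (e.toTrivialization.mem_source.2 hm)))

theorem contMDiffAt_proj {m : M} (hm : π m ∈ e.baseSet) :
    ContMDiffAt 𝓘(ℝ, EM) 𝓘(ℝ, EB) ∞ π m := by
  have hs := e.open_source.mem_nhds (e.toTrivialization.mem_source.2 hm)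
  refine (ContMDiffAt.comp m (contMDiff_fst (J := 𝓘(ℝ, EF))).contMDiffAt
    (e.contMDiffOn_toFun.contMDiffAt hs)).congr_of_eventuallyEq ?_
  filter_upwards [hs] with x hx using (e.toTrivialization.coe_fst hx).symm

theorem mfderiv_param_mem_vertical (hb : b ∈ e.baseSet) (f : F) (w : TangentSpace 𝓘(ℝ, EF) f) :
    mfderiv 𝓘(ℝ, EF) 𝓘(ℝ, EM) (e.param b) f w ∈ vertical EM EB π (e.param b f) := by
  have h₁ : MDifferentiableAt 𝓘(ℝ, EM) 𝓘(ℝ, EB) π (e.param b f) :=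
    (e.contMDiffAt_proj (by rwa [e.proj_param hb])).mdifferentiableAt (by simp)
  have h := mfderiv_comp f h₁ ((e.contMDiff_param hb f).mdifferentiableAt (by simp))
  have h₂ : π ∘ e.param b = fun _ ↦ b := funext fun f ↦ e.proj_param hb f
  rw [h₂, mfderiv_const] at h
  exact (DFunLike.congr_fun h w).symm

/-- Every vertical vector is tangent to the parametrization of the fibre. -/
theorem exists_mfderiv_param_eq (hb : b ∈ e.baseSet) (f : F)
    {u : TangentSpace 𝓘(ℝ, EM) (e.param b f)} (hu : u ∈ vertical EM EB π (e.param b f)) :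
    ∃ w, mfderiv 𝓘(ℝ, EF) 𝓘(ℝ, EM) (e.param b) f w = u := by
  have hπm : π (e.param b f) = b := e.proj_param hb f
  have hmb : π (e.param b f) ∈ e.baseSet := by rwa [hπm]
  let G := fun x : M ↦ (π x, e.coord x)
  have hπ := ((e.contMDiffAt_proj hmb).mdifferentiableAt (by simp)).hasMFDerivAt
  have hc := ((e.contMDiffAt_coord hmb).mdifferentiableAt (by simp)).hasMFDerivAt
  have hGm : G (e.param b f) = (b, f) := Prod.ext hπm (e.coord_param hb f)
  have hsymm : MDifferentiableAt (𝓘(ℝ, EB).prod 𝓘(ℝ, EF)) 𝓘(ℝ, EM)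
      e.toOpenPartialHomeomorph.symm (b, f) :=
    (e.contMDiffOn_invFun.contMDiffAt
      (e.open_target.mem_nhds (e.mk_mem_target hb f))).mdifferentiableAt (by simp)
  let D : EB × EF →L[ℝ] EM := mfderiv (𝓘(ℝ, EB).prod 𝓘(ℝ, EF)) 𝓘(ℝ, EM)
    e.toOpenPartialHomeomorph.symm (b, f)
  have hD : ∀ p, p = (b, f) → HasMFDerivAt (𝓘(ℝ, EB).prod 𝓘(ℝ, EF)) 𝓘(ℝ, EM)
      e.toOpenPartialHomeomorph.symm p D := by
    rintro _ rfl; exact hsymm.hasMFDerivAt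
  have hid : e.toOpenPartialHomeomorph.symm ∘ G =ᶠ[𝓝 (e.param b f)] id := by
    filter_upwards [e.isOpen_preimage_baseSet.mem_nhds hmb] with x hx
    exact e.param_proj_coord hx
  have h₁ := (HasMFDerivAt.comp _ (hD _ hGm) (hπ.prodMk hc)).mfderiv
  rw [hid.mfderiv_eq, mfderiv_id] at h₁
  have h₂ := HasMFDerivAt.comp f (hD ((fun y ↦ (b, y)) f) rfl)
    ((contMDiff_const.prodMk contMDiff_id : ContMDiff 𝓘(ℝ, EF) (𝓘(ℝ, EB).prod 𝓘(ℝ, EF)) ∞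
      (fun y ↦ (b, y))).mdifferentiable (by simp) f).hasMFDerivAt
  rw [mfderiv_prod_right] at h₂
  refine ⟨mfderiv 𝓘(ℝ, EM) 𝓘(ℝ, EF) e.coord (e.param b f) u, ?_⟩
  refine (DFunLike.congr_fun h₂.mfderiv _).trans
    (Eq.trans (congrArg D ?_) (DFunLike.congr_fun h₁ u).symm)
  exact Prod.ext (Eq.symm hu) rfl

end SmoothTrivialization

theorem IsSmoothFiberBundle.contMDiff (hπ : IsSmoothFiberBundle EM EB EF F π) :
    ContMDiff 𝓘(ℝ, EM) 𝓘(ℝ, EB) ∞ π := fun m ↦ by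
  obtain ⟨e, he⟩ := hπ (π m)
  exact e.contMDiffAt_proj he

/-- The intrinsic content of the contact condition on the fibres, for a defining form `α`: `α` does
not vanish on the vertical space, and `dα` is nondegenerate on `ξ ∩ V`. -/
theorem IsContactOnFibers.nondegenerate [FiniteDimensional ℝ EM] [FiniteDimensional ℝ EF]
    [IsManifold 𝓘(ℝ, EM) ∞ M] [IsManifold 𝓘(ℝ, EF) ∞ F] {ξ : CoorientedField EM M}
    (hξ : IsContactOnFibers EB EF F π ξ) {α : ∀ m : M, TangentSpace 𝓘(ℝ, EM) m →L[ℝ] ℝ}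
    (hα : ξ.IsKernelForm α) (m : M) :
    (∃ w ∈ vertical EM EB π m, α m w ≠ 0) ∧
      ∀ w ∈ ξ.plane m ⊓ vertical EM EB π m,
        (∀ w' ∈ ξ.plane m ⊓ vertical EM EB π m, extDerivOneForm α m w w' = 0) → w = 0 := by
  obtain ⟨b, hb⟩ : ∃ b, b = π m := ⟨_, rfl⟩
  obtain ⟨e, hbe, β', ⟨⟨hβ', hβ'0⟩, hnd⟩⟩ := hξ b
  obtain ⟨f, rfl⟩ : ∃ f, m = e.param b f :=
    ⟨e.coord m, by rw [hb, e.param_proj_coord (hb ▸ hbe)]⟩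
  have hι := e.contMDiff_param hbe
  let β : ∀ f : F, TangentSpace 𝓘(ℝ, EF) f →L[ℝ] ℝ := pullbackForm α (e.param b)
  have hβ : (ξ.pullback EF (e.param b)).IsKernelForm β := by
    refine ⟨hα.1.pullbackForm hι, fun n ↦ ?_⟩
    ext w
    change _ ∈ ξ.plane _ ↔ _
    rw [hα.2]
    exact Iff.rfl
  have hβf : β f ≠ 0 := fun h ↦ (hβ'0 f).1 <| by
    have h₁ := (hβ.2 f).symm.trans (hβ'.2 f)
    ext w
    have h₂ : w ∈ LinearMap.ker (β f).toLinearMap := by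
      change β f w = 0
      rw [h]; rfl
    rw [h₁] at h₂
    exact h₂
  constructor
  · by_contra! h
    exact hβf (ContinuousLinearMap.ext fun w ↦ h _ (e.mfderiv_param_mem_vertical hbe f w))
  · rintro w ⟨hw₁, hw₂⟩ hw
    obtain ⟨v, rfl⟩ := e.exists_mfderiv_param_eq hbe f hw₂
    obtain ⟨g, -, hg⟩ := hβ.exists_extDerivOneForm_eq hβ' hβf
    have hv : v = 0 := hnd f v hw₁ fun v' hv' ↦ by
      rw [hg v hw₁ v' hv', hα.1.extDerivOneForm_pullbackForm hι]
      exact mul_eq_zero_of_right _ (hw _ ⟨hv', e.mfderiv_param_mem_vertical hbe f v'⟩)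
    rw [hv, map_zero]

end Trivializations

/-! ### Adapted charts and the connection -/

section AdaptedCharts

variable {EM EB EF : Type*} [NormedAddCommGroup EM] [NormedSpace ℝ EM]
  [NormedAddCommGroup EB] [NormedSpace ℝ EB] [NormedAddCommGroup EF] [NormedSpace ℝ EF]
  {M B F : Type*} [TopologicalSpace M] [ChartedSpace EM M] [TopologicalSpace B] [ChartedSpace EB B]
  [TopologicalSpace F] [ChartedSpace EF F] {π : M → B}

variable (EM EB EF) in
/-- A smooth chart of the total space with values in `EB × EF` that is adapted to `π`: its first
component is the expression of `π` in a smooth chart of the base. -/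
structure AdaptedChart (π : M → B) where
  /-- the chart of the total space -/
  total : OpenPartialHomeomorph M (EB × EF)
  /-- the chart of the base -/
  base : OpenPartialHomeomorph B EB
  contMDiffOn_total : ContMDiffOn 𝓘(ℝ, EM) 𝓘(ℝ, EB × EF) ∞ total total.source
  contMDiffOn_total_symm : ContMDiffOn 𝓘(ℝ, EB × EF) 𝓘(ℝ, EM) ∞ total.symm total.target
  contMDiffOn_base : ContMDiffOn 𝓘(ℝ, EB) 𝓘(ℝ, EB) ∞ base base.source
  contMDiffOn_base_symm : ContMDiffOn 𝓘(ℝ, EB) 𝓘(ℝ, EB) ∞ base.symm base.target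
  proj_mem : ∀ m ∈ total.source, π m ∈ base.source
  fst_total : ∀ m ∈ total.source, (total m).1 = base (π m)

theorem IsSmoothFiberBundle.exists_adaptedChart [IsManifold 𝓘(ℝ, EB) ∞ B]
    [IsManifold 𝓘(ℝ, EF) ∞ F] (hπ : IsSmoothFiberBundle EM EB EF F π) (m : M) :
    ∃ c : AdaptedChart EM EB EF π, m ∈ c.total.source := by
  obtain ⟨e, he⟩ := hπ (π m)
  let χB := chartAt EB (π m)
  let χF := chartAt EF (e.coord m)
  let Θ : OpenPartialHomeomorph M (EB × EF) := e.toOpenPartialHomeomorph.trans (χB.prod χF)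
  have hsource : ∀ x ∈ Θ.source, x ∈ e.source ∧ π x ∈ χB.source ∧ e.coord x ∈ χF.source := by
    intro x hx
    have h₁ : x ∈ e.source := hx.1
    have h₂ : (e.toOpenPartialHomeomorph x).1 ∈ χB.source ∧
      (e.toOpenPartialHomeomorph x).2 ∈ χF.source := hx.2
    have h₃ : (e.toOpenPartialHomeomorph x).1 = π x := e.toTrivialization.coe_fst h₁
    rw [h₃] at h₂
    exact ⟨h₁, h₂.1, h₂.2⟩
  have hΘ : ∀ x ∈ Θ.source, Θ x = (χB (π x), χF (e.coord x)) := fun x hx ↦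
    Prod.ext (congrArg χB (e.toTrivialization.coe_fst (hsource x hx).1)) rfl
  have htarget : ∀ x ∈ Θ.target, x.1 ∈ χB.target ∧ x.2 ∈ χF.target ∧
      (χB.symm x.1, χF.symm x.2) ∈ e.target := fun x hx ↦ ⟨hx.1.1, hx.1.2, hx.2⟩
  refine ⟨⟨Θ, χB, ?_, ?_, contMDiffOn_chart, contMDiffOn_chart_symm, fun x hx ↦ (hsource x hx).2.1,
    fun x hx ↦ by rw [hΘ x hx]⟩, ?_⟩
  · refine ContMDiffOn.congr (f := fun x ↦ (χB (π x), χF (e.coord x))) ?_ hΘ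
    refine ContMDiffOn.prodMk_space ?_ ?_
    · exact contMDiffOn_chart.comp hπ.contMDiff.contMDiffOn fun x hx ↦ (hsource x hx).2.1
    · refine contMDiffOn_chart.comp (fun x hx ↦ ?_) fun x hx ↦ (hsource x hx).2.2
      exact (e.contMDiffAt_coord (e.toTrivialization.mem_source.1
        (hsource x hx).1)).contMDiffWithinAt
  · have h₁ : ContMDiffOn 𝓘(ℝ, EB × EF) (𝓘(ℝ, EB).prod 𝓘(ℝ, EF)) ∞
        (fun x : EB × EF ↦ (χB.symm x.1, χF.symm x.2)) Θ.target :=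
      (contMDiffOn_chart_symm.comp contDiff_fst.contMDiff.contMDiffOn
        fun x hx ↦ (htarget x hx).1).prodMk
      (contMDiffOn_chart_symm.comp contDiff_snd.contMDiff.contMDiffOn
        fun x hx ↦ (htarget x hx).2.1)
    exact e.contMDiffOn_invFun.comp h₁ fun x hx ↦ (htarget x hx).2.2
  · have h₁ : m ∈ e.source := e.toTrivialization.mem_source.2 he
    refine ⟨h₁, ?_⟩
    change (e.toOpenPartialHomeomorph m).1 ∈ χB.source ∧ (e.toOpenPartialHomeomorph m).2 ∈ χF.source
    have h₃ : (e.toOpenPartialHomeomorph m).1 = π m := e.toTrivialization.coe_fst h₁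
    rw [h₃]
    exact ⟨mem_chart_source _ _, mem_chart_source _ _⟩

namespace AdaptedChart

variable (c : AdaptedChart EM EB EF π)

/-- The differential of the inverse chart, as a linear map between the model spaces. -/
def frame (x : EB × EF) : EB × EF →L[ℝ] EM :=
  mfderiv 𝓘(ℝ, EB × EF) 𝓘(ℝ, EM) c.total.symm x

theorem mdifferentiableAt_symm {x : EB × EF} (hx : x ∈ c.total.target) :
    MDifferentiableAt 𝓘(ℝ, EB × EF) 𝓘(ℝ, EM) c.total.symm x :=
  (c.contMDiffOn_total_symm.contMDiffAt
    (c.total.open_target.mem_nhds hx)).mdifferentiableAt (by simp)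

theorem mdifferentiableAt_total {m : M} (hm : m ∈ c.total.source) :
    MDifferentiableAt 𝓘(ℝ, EM) 𝓘(ℝ, EB × EF) c.total m :=
  (c.contMDiffOn_total.contMDiffAt
    (c.total.open_source.mem_nhds hm)).mdifferentiableAt (by simp)

theorem frame_mfderiv_total {m : M} (hm : m ∈ c.total.source) (u : EM) :
    c.frame (c.total m) (mfderiv 𝓘(ℝ, EM) 𝓘(ℝ, EB × EF) c.total m u) = u := by
  have h := mfderiv_comp m (c.mdifferentiableAt_symm (c.total.map_source hm))
    (c.mdifferentiableAt_total hm)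
  have h' : c.total.symm ∘ c.total =ᶠ[𝓝 m] id :=
    Filter.eventually_of_mem (c.total.open_source.mem_nhds hm) fun y hy ↦ c.total.left_inv hy
  rw [h'.mfderiv_eq, mfderiv_id] at h
  exact (DFunLike.congr_fun h u).symm

theorem mfderiv_total_frame {x : EB × EF} (hx : x ∈ c.total.target) (z : EB × EF) :
    mfderiv 𝓘(ℝ, EM) 𝓘(ℝ, EB × EF) c.total (c.total.symm x) (c.frame x z) = z := by
  have h := mfderiv_comp x (c.mdifferentiableAt_total (c.total.map_target hx))
    (c.mdifferentiableAt_symm hx)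
  have h' : c.total ∘ c.total.symm =ᶠ[𝓝 x] id :=
    Filter.eventually_of_mem (c.total.open_target.mem_nhds hx) fun y hy ↦ c.total.right_inv hy
  rw [h'.mfderiv_eq, mfderiv_id] at h
  exact (DFunLike.congr_fun h z).symm

theorem frame_injective {x : EB × EF} (hx : x ∈ c.total.target) :
    Function.Injective (c.frame x) := fun z z' h ↦ by
  rw [← c.mfderiv_total_frame hx z, h, c.mfderiv_total_frame hx z']

theorem frame_surjective {x : EB × EF} (hx : x ∈ c.total.target) :
    Function.Surjective (c.frame x) := fun u ↦ by
  have h := c.frame_mfderiv_total (c.total.map_target hx) u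
  rw [c.total.right_inv hx] at h
  exact ⟨_, h⟩

theorem proj_symm {x : EB × EF} (hx : x ∈ c.total.target) :
    x.1 ∈ c.base.target ∧ π (c.total.symm x) = c.base.symm x.1 := by
  have hm := c.total.map_target hx
  have h := c.fst_total _ hm
  rw [c.total.right_inv hx] at h
  have h' := c.proj_mem _ hm
  rw [h]
  exact ⟨c.base.map_source h', (c.base.left_inv h').symm⟩

theorem frame_mem_vertical_iff (hπ : ContMDiff 𝓘(ℝ, EM) 𝓘(ℝ, EB) ∞ π) {x : EB × EF}
    (hx : x ∈ c.total.target) (z : EB × EF) :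
    c.frame x z ∈ vertical EM EB π (c.total.symm x) ↔ z.1 = 0 := by
  have hx₁ := (c.proj_symm hx).1
  have hs : MDifferentiableAt 𝓘(ℝ, EB) 𝓘(ℝ, EB) c.base.symm x.1 :=
    (c.contMDiffOn_base_symm.contMDiffAt
      (c.base.open_target.mem_nhds hx₁)).mdifferentiableAt (by simp)
  have hb : MDifferentiableAt 𝓘(ℝ, EB) 𝓘(ℝ, EB) c.base (c.base.symm x.1) :=
    (c.contMDiffOn_base.contMDiffAt
      (c.base.open_source.mem_nhds (c.base.map_target hx₁))).mdifferentiableAt (by simp)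
  have h₁ := mfderiv_comp x ((hπ _).mdifferentiableAt (by simp)) (c.mdifferentiableAt_symm hx)
  have h₂ : π ∘ c.total.symm =ᶠ[𝓝 x] c.base.symm ∘ Prod.fst :=
    Filter.eventually_of_mem (c.total.open_target.mem_nhds hx) fun y hy ↦ (c.proj_symm hy).2
  have h₃ := mfderiv_comp x hs ((contDiff_fst (n := ∞)).contMDiff.mdifferentiable (by simp) x)
  rw [h₂.mfderiv_eq, h₃, mfderiv_eq_fderiv, fderiv_fst] at h₁
  have h₄ := DFunLike.congr_fun h₁ z
  have h₅ := mfderiv_comp x.1 hb hs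
  have h₆ : c.base ∘ c.base.symm =ᶠ[𝓝 x.1] id :=
    Filter.eventually_of_mem (c.base.open_target.mem_nhds hx₁) fun y hy ↦ c.base.right_inv hy
  rw [h₆.mfderiv_eq, mfderiv_id] at h₅
  have h₇ : mfderiv 𝓘(ℝ, EM) 𝓘(ℝ, EB) π (c.total.symm x) (c.frame x z) =
    mfderiv 𝓘(ℝ, EB) 𝓘(ℝ, EB) c.base.symm x.1 z.1 := h₄.symm
  change mfderiv 𝓘(ℝ, EM) 𝓘(ℝ, EB) π (c.total.symm x) (c.frame x z) = 0 ↔ _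
  rw [h₇]
  constructor
  · intro h
    have h₈ := DFunLike.congr_fun h₅ z.1
    have h₉ : mfderiv 𝓘(ℝ, EB) 𝓘(ℝ, EB) c.base (c.base.symm x.1)
        (mfderiv 𝓘(ℝ, EB) 𝓘(ℝ, EB) c.base.symm x.1 z.1) = 0 :=
      (congrArg _ h).trans (map_zero _)
    exact h₈.trans h₉
  · intro h
    rw [h]
    exact map_zero _

end AdaptedChart

end AdaptedCharts

section Connection

variable {EM EB EF : Type*} [NormedAddCommGroup EM] [NormedSpace ℝ EM] [FiniteDimensional ℝ EM]
  [NormedAddCommGroup EB] [NormedSpace ℝ EB] [FiniteDimensional ℝ EB]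
  [NormedAddCommGroup EF] [NormedSpace ℝ EF] [FiniteDimensional ℝ EF]
  {M B F : Type*} [TopologicalSpace M] [ChartedSpace EM M] [IsManifold 𝓘(ℝ, EM) ∞ M]
  [TopologicalSpace B] [ChartedSpace EB B] [TopologicalSpace F] [ChartedSpace EF F]
  {π : M → B}

variable (EB) in
/-- The perpendicular of `ξ ∩ V` in `(ξ, dα)`, as a field of subspaces. It is defined for every
field of 1-forms `α`, and is a connection if `ker α = ξ` is contact on the fibres. -/
def contactConnection (π : M → B) (ξ : CoorientedField EM M)
    (α : ∀ m : M, TangentSpace 𝓘(ℝ, EM) m →L[ℝ] ℝ) (m : M) :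
    Submodule ℝ (TangentSpace 𝓘(ℝ, EM) m) where
  carrier := contactPerp EB π ξ α m
  add_mem' := fun {u v} hu hv ↦ ⟨(ξ.plane m).add_mem hu.1 hv.1, fun w hw ↦ by
    have h₁ : flatExtDeriv _ _ _ _ = (0 : ℝ) := hu.2 w hw
    have h₂ : flatExtDeriv _ _ _ _ = (0 : ℝ) := hv.2 w hw
    rw [extDerivOneForm_eq, map_add]
    refine (DFunLike.congr_fun (map_add (flatExtDeriv _ _) _ _) _).trans ?_
    exact (congrArg₂ (· + ·) h₁ h₂).trans (add_zero 0)⟩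
  zero_mem' := ⟨(ξ.plane m).zero_mem, fun w _ ↦ by
    rw [extDerivOneForm_eq, map_zero]
    exact DFunLike.congr_fun (map_zero (flatExtDeriv _ _)) _⟩
  smul_mem' := fun r u hu ↦ ⟨(ξ.plane m).smul_mem r hu.1, fun w hw ↦ by
    have h₁ : flatExtDeriv _ _ _ _ = (0 : ℝ) := hu.2 w hw
    rw [extDerivOneForm_eq, map_smul]
    refine (DFunLike.congr_fun (map_smul (flatExtDeriv _ _) _ _) _).trans ?_
    exact (congrArg (r • ·) h₁).trans (smul_zero r)⟩

theorem mem_contactConnection {ξ : CoorientedField EM M}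
    {α : ∀ m : M, TangentSpace 𝓘(ℝ, EM) m →L[ℝ] ℝ} {m : M} {u : TangentSpace 𝓘(ℝ, EM) m} :
    u ∈ contactConnection EB π ξ α m ↔ u ∈ ξ.plane m ∧
      ∀ w ∈ ξ.plane m ⊓ vertical EM EB π m, extDerivOneForm α m u w = 0 := Iff.rfl

/-- The perpendicular does not depend on the form with kernel `ξ`. -/
theorem CoorientedField.IsKernelForm.contactPerp_eq {ξ : CoorientedField EM M}
    {α α' : ∀ m : M, TangentSpace 𝓘(ℝ, EM) m →L[ℝ] ℝ}
    (hα : ξ.IsKernelForm α) (hα' : ξ.IsKernelForm α') {m : M} (h0 : α m ≠ 0) :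
    contactPerp EB π ξ α m = contactPerp EB π ξ α' m := by
  obtain ⟨g, hg, h⟩ := hα.exists_extDerivOneForm_eq hα' h0
  ext u
  refine and_congr_right fun hu ↦ forall₂_congr fun w hw ↦ ?_
  rw [h u hu w hw.1, mul_eq_zero, or_iff_right hg]

variable {ξ : CoorientedField EM M} {α : ∀ m : M, TangentSpace 𝓘(ℝ, EM) m →L[ℝ] ℝ}

theorem AdaptedChart.frame_mem_plane_iff (c : AdaptedChart EM EB EF π) (hα : ξ.IsKernelForm α)
    (x z : EB × EF) : c.frame x z ∈ ξ.plane (c.total.symm x) ↔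
      formInCoord α c.total.symm x z = 0 := by
  rw [hα.2]; exact Iff.rfl

/-- The form `α` in an adapted chart. -/
theorem AdaptedChart.isFiberContactForm [IsManifold 𝓘(ℝ, EF) ∞ F] (c : AdaptedChart EM EB EF π)
    (hπ : IsSmoothFiberBundle EM EB EF F π) (hξ : IsContactOnFibers EB EF F π ξ)
    (hα : ξ.IsKernelForm α) :
    IsFiberContactForm (formInCoord α c.total.symm) c.total.target where
  isOpen := c.total.open_target
  contDiffOn := hα.1.contDiffOn_formInCoord c.total.open_target c.contMDiffOn_total_symm
  exists_ne_zero x hx := by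
    obtain ⟨w, hw, hw'⟩ := (hξ.nondegenerate hα (c.total.symm x)).1
    obtain ⟨⟨z₁, z₂⟩, rfl⟩ := c.frame_surjective hx w
    obtain rfl : z₁ = 0 := (c.frame_mem_vertical_iff hπ.contMDiff hx _).1 hw
    exact ⟨z₂, hw'⟩
  nondegenerate x hx w hw hw' := by
    have h := (hξ.nondegenerate hα (c.total.symm x)).2 (c.frame x (0, w))
      ⟨(c.frame_mem_plane_iff hα x _).2 hw, (c.frame_mem_vertical_iff hπ.contMDiff hx _).2 rfl⟩ ?_
    · have h₁ : ((0 : EB), w) = 0 := c.frame_injective hx (h.trans (map_zero _).symm)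
      exact congrArg Prod.snd h₁
    · rintro v ⟨hv, hv'⟩
      obtain ⟨⟨z₁, z₂⟩, rfl⟩ := c.frame_surjective hx v
      obtain rfl : z₁ = 0 := (c.frame_mem_vertical_iff hπ.contMDiff hx _).1 hv'
      exact (hα.1.flatExtDeriv_formInCoord c.total.open_target c.contMDiffOn_total_symm hx
        _ _).symm.trans (hw' z₂ ((c.frame_mem_plane_iff hα x _).1 hv))

/-- In an adapted chart the connection is the graph of the horizontal map of the local model. -/
theorem AdaptedChart.frame_mem_contactConnection_iff [IsManifold 𝓘(ℝ, EF) ∞ F]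
    (c : AdaptedChart EM EB EF π)
    (hπ : IsSmoothFiberBundle EM EB EF F π) (hξ : IsContactOnFibers EB EF F π ξ)
    (hα : ξ.IsKernelForm α) {x : EB × EF} (hx : x ∈ c.total.target) {X : EB →L[ℝ] EF}
    (hX : IsHorizontalAt (formInCoord α c.total.symm) x X) (z : EB × EF) :
    c.frame x z ∈ contactConnection EB π ξ α (c.total.symm x) ↔ z.2 = X z.1 := by
  have hplane := c.frame_mem_plane_iff hα x
  have hd : ∀ z z', flatExtDeriv (formInCoord α c.total.symm) x z z' =
      extDerivOneForm α (c.total.symm x) (c.frame x z) (c.frame x z') :=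
    hα.1.flatExtDeriv_formInCoord c.total.open_target c.contMDiffOn_total_symm hx
  have hiff : c.frame x z ∈ contactConnection EB π ξ α (c.total.symm x) ↔
      formInCoord α c.total.symm x z = 0 ∧ ∀ w : EF, formInCoord α c.total.symm x (0, w) = 0 →
        flatExtDeriv (formInCoord α c.total.symm) x z (0, w) = 0 := by
    refine mem_contactConnection.trans (and_congr (hplane z) ⟨fun h w hw ↦ ?_, fun h v hv ↦ ?_⟩)
    · rw [hd]
      exact h _ ⟨(hplane _).2 hw, (c.frame_mem_vertical_iff hπ.contMDiff hx _).2 rfl⟩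
    · obtain ⟨⟨z₁, z₂⟩, rfl⟩ := c.frame_surjective hx v
      obtain rfl : z₁ = 0 := (c.frame_mem_vertical_iff hπ.contMDiff hx _).1 hv.2
      rw [← hd]
      exact h z₂ ((hplane _).1 hv.1)
  obtain ⟨z₁, z₂⟩ := z
  rw [hiff]
  constructor
  · rintro ⟨h₁, h₂⟩
    exact (c.isFiberContactForm hπ hξ hα).eq_of_isHorizontalAt hx hX h₁ h₂
  · intro h
    obtain rfl : z₂ = X z₁ := h
    exact hX z₁

theorem isConnection_contactConnection [IsManifold 𝓘(ℝ, EB) ∞ B] [IsManifold 𝓘(ℝ, EF) ∞ F]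
    (hπ : IsSmoothFiberBundle EM EB EF F π) (hξ : IsContactOnFibers EB EF F π ξ)
    (hα : ξ.IsKernelForm α) : IsConnection EB π (contactConnection EB π ξ α) := by
  refine ⟨fun m₀ ↦ ?_, fun m ↦ ?_⟩
  · obtain ⟨c, hc⟩ := hπ.exists_adaptedChart m₀
    obtain ⟨X, R, hX, -, hXR⟩ := (c.isFiberContactForm hπ hξ hα).exists_horizontal
    let b := Module.finBasis ℝ EB
    -- the horizontal lifts of a constant frame of the base
    let Y : Fin (Module.finrank ℝ EB) → M → EM := fun i m ↦
      c.frame (c.total m) (b i, X (c.total m) (b i))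
    have hYmem : ∀ m ∈ c.total.source, ∀ u : EM, u ∈ contactConnection EB π ξ α m ↔
        ∃ v, u = c.frame (c.total m) (v, X (c.total m) v) := by
      intro m hm u
      obtain ⟨x, hx, rfl⟩ : ∃ x ∈ c.total.target, m = c.total.symm x :=
        ⟨_, c.total.map_source hm, (c.total.left_inv hm).symm⟩
      rw [c.total.right_inv hx]
      obtain ⟨z, rfl⟩ := c.frame_surjective hx u
      refine (c.frame_mem_contactConnection_iff hπ hξ hα hx (hXR x hx).1 z).trans
        ⟨fun h ↦ ⟨z.1, by rw [← h]⟩, ?_⟩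
      rintro ⟨v, hv⟩
      rw [c.frame_injective hx hv]
    refine ⟨c.total.source, c.total.open_source, hc, _, Y, fun i ↦ ?_, fun m hm ↦ ⟨?_, ?_⟩⟩
    · have h₁ := c.contMDiffOn_total_symm.contMDiffOn_tangentMapWithin (m := ∞) (by simp)
        c.total.open_target.uniqueMDiffOn
      have h₂ : ContMDiffOn 𝓘(ℝ, EB × EF) 𝓘(ℝ, EB × EF).tangent ∞
          (fun x ↦ (⟨x, (b i, X x (b i))⟩ : TangentBundle 𝓘(ℝ, EB × EF) (EB × EF)))
          c.total.target :=
        contMDiffOn_vectorSpace_iff_contDiffOn.2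
          (contDiffOn_const.prodMk (hX.clm_apply contDiffOn_const))
      refine ((h₁.comp h₂ fun x hx ↦ hx).comp c.contMDiffOn_total
        fun m hm ↦ c.total.map_source hm).congr fun m hm ↦ ?_
      have h₃ : ∀ m', m' = m → ∀ v : EM, (⟨m, v⟩ : TangentBundle 𝓘(ℝ, EM) M) = ⟨m', v⟩ := by
        rintro _ rfl v; rfl
      refine (h₃ _ (c.total.left_inv hm) (Y i m)).trans ?_
      simp only [Y, AdaptedChart.frame]
      rw [← mfderivWithin_of_isOpen c.total.open_target (c.total.map_source hm)]
      rfl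
    · refine Fintype.linearIndependent_iff.2 fun g hg i ↦ ?_
      have h₁ : c.frame (c.total m) (∑ i, g i • (b i, X (c.total m) (b i))) = 0 := by
        rw [map_sum]
        refine Eq.trans (Finset.sum_congr rfl fun i _ ↦ ?_) hg
        exact map_smul _ _ _
      have h₂ := c.frame_injective (c.total.map_source hm) (h₁.trans (map_zero _).symm)
      have h₃ := congrArg Prod.fst h₂
      rw [Prod.fst_sum] at h₃
      exact Fintype.linearIndependent_iff.1 b.linearIndependent g h₃ i
    · apply le_antisymm
      · rw [Submodule.span_le]
        rintro _ ⟨i, rfl⟩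
        exact (hYmem m hm _).2 ⟨b i, rfl⟩
      · intro u hu
        obtain ⟨v, rfl⟩ := (hYmem m hm u).1 hu
        have h₁ : c.frame (c.total m) (v, X (c.total m) v) =
            ∑ i, b.repr v i • (Y i m : EM) := by
          have hXv : X (c.total m) v = ∑ i, b.repr v i • X (c.total m) (b i) := by
            conv_lhs => rw [← b.sum_repr v]
            rw [map_sum]
            exact Finset.sum_congr rfl fun i _ ↦ map_smul _ _ _
          have h₂ : (v, X (c.total m) v) = ∑ i, b.repr v i • (b i, X (c.total m) (b i)) := by
            refine Prod.ext ?_ ?_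
            · rw [Prod.fst_sum]; exact (b.sum_repr v).symm
            · rw [Prod.snd_sum]; exact hXv
          rw [h₂, map_sum]
          exact Finset.sum_congr rfl fun i _ ↦ map_smul _ _ _
        rw [h₁]
        exact Submodule.sum_mem _ fun i _ ↦
          Submodule.smul_mem _ _ (Submodule.subset_span ⟨i, rfl⟩)
  · obtain ⟨c, hc⟩ := hπ.exists_adaptedChart m
    obtain ⟨X, R, -, -, hXR⟩ := (c.isFiberContactForm hπ hξ hα).exists_horizontal
    obtain ⟨x, hx, rfl⟩ : ∃ x ∈ c.total.target, m = c.total.symm x :=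
      ⟨_, c.total.map_source hc, (c.total.left_inv hc).symm⟩
    have hH := c.frame_mem_contactConnection_iff hπ hξ hα hx (hXR x hx).1
    have hV := c.frame_mem_vertical_iff hπ.contMDiff hx
    refine isCompl_iff.2 ⟨?_, ?_⟩
    · rw [Submodule.disjoint_def]
      intro u hu hu'
      obtain ⟨z, rfl⟩ := c.frame_surjective hx u
      have h₁ := (hV z).1 hu'
      have h₂ := (hH z).1 hu
      rw [h₁, map_zero] at h₂
      have h₃ : z = 0 := Prod.ext h₁ h₂
      rw [h₃]
      exact map_zero _
    · rw [Submodule.codisjoint_iff_exists_add_eq]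
      intro u
      obtain ⟨z, rfl⟩ := c.frame_surjective hx u
      refine ⟨c.frame x (z.1, X x z.1), c.frame x (0, z.2 - X x z.1), (hH _).2 rfl, (hV _).2 rfl,
        ?_⟩
      refine (map_add (c.frame x) _ _).symm.trans (congrArg (c.frame x) ?_)
      ext <;> simp

end Connection

/-! ### Uniqueness of horizontal lifts -/

section IntervalPropagation

/-- A property that holds near `t₀` in `[a, b]` holds on an interval of positive length less than
`δ` which is a neighbourhood of `t₀` in `[a, b]`. -/
theorem exists_Icc_of_eventually {a b t₀ δ : ℝ} (hab : a < b) (ht₀ : t₀ ∈ Icc a b) {Q : ℝ → Prop}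
    (hQ : ∀ᶠ t in 𝓝[Icc a b] t₀, Q t) (hδ : 0 < δ) :
    ∃ a' b', a' < b' ∧ b' - a' < δ ∧ Icc a' b' ⊆ Icc a b ∧ Icc a' b' ∈ 𝓝[Icc a b] t₀ ∧
      t₀ ∈ Icc a' b' ∧ ∀ t ∈ Icc a' b', Q t := by
  obtain ⟨ε, hε, hball⟩ := Metric.mem_nhdsWithin_iff.1 hQ
  let r := min (ε / 2) (δ / 3)
  have hr : 0 < r := lt_min (half_pos hε) (by positivity)
  have hrε : r < ε := (min_le_left _ _).trans_lt (half_lt_self hε)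
  have hrδ : r ≤ δ / 3 := min_le_right _ _
  refine ⟨max a (t₀ - r), min b (t₀ + r), ?_, ?_, ?_, ?_, ?_, fun t ht ↦ ?_⟩
  · refine max_lt (lt_min hab ?_) (lt_min ?_ ?_) <;> linarith [ht₀.1, ht₀.2]
  · have h₁ := le_max_right a (t₀ - r)
    have h₂ := min_le_right b (t₀ + r)
    linarith
  · exact Icc_subset_Icc (le_max_left _ _) (min_le_left _ _)
  · rw [← Icc_inter_Icc]
    exact Filter.inter_mem self_mem_nhdsWithin
      (mem_nhdsWithin_of_mem_nhds (Icc_mem_nhds (by linarith) (by linarith)))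
  · exact ⟨max_le ht₀.1 (by linarith), le_min ht₀.2 (by linarith)⟩
  · rw [← Icc_inter_Icc] at ht
    refine hball ⟨?_, ht.1⟩
    rw [Metric.mem_ball, Real.dist_eq, abs_lt]
    constructor <;> linarith [ht.2.1, ht.2.2]

/-- A property that propagates between nearby times propagates over the whole interval, by
connectedness. -/
theorem forall_Icc_of_locally_constant {a b : ℝ} {P : ℝ → Prop}
    (h : ∀ t₀ ∈ Icc a b, ∃ W ∈ 𝓝[Icc a b] t₀, ∀ s ∈ W ∩ Icc a b, ∀ t ∈ W ∩ Icc a b, P s → P t)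
    {s t : ℝ} (hs : s ∈ Icc a b) (ht : t ∈ Icc a b) (hP : P s) : P t := by
  have : PreconnectedSpace (Icc a b) := Subtype.preconnectedSpace isPreconnected_Icc
  have hloc : IsLocallyConstant fun τ : Icc a b ↦ P τ := by
    rw [IsLocallyConstant.iff_eventually_eq]
    intro τ
    obtain ⟨W, hW, hW'⟩ := h τ τ.2
    have h₀ : (τ : ℝ) ∈ W := mem_of_mem_nhdsWithin τ.2 hW
    filter_upwards [preimage_coe_mem_nhds_subtype.2 hW] with σ hσ
    exact propext ⟨hW' _ ⟨hσ, σ.2⟩ _ ⟨h₀, τ.2⟩, hW' _ ⟨h₀, τ.2⟩ _ ⟨hσ, σ.2⟩⟩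
  exact (hloc.apply_eq_of_preconnectedSpace ⟨s, hs⟩ ⟨t, ht⟩) ▸ hP

end IntervalPropagation

section HorizontalLifts

variable {EM EB EF : Type*} [NormedAddCommGroup EM] [NormedSpace ℝ EM] [FiniteDimensional ℝ EM]
  [NormedAddCommGroup EB] [NormedSpace ℝ EB] [FiniteDimensional ℝ EB]
  [NormedAddCommGroup EF] [NormedSpace ℝ EF] [FiniteDimensional ℝ EF]
  {M B F : Type*} [TopologicalSpace M] [ChartedSpace EM M] [IsManifold 𝓘(ℝ, EM) ∞ M]
  [TopologicalSpace B] [ChartedSpace EB B] [IsManifold 𝓘(ℝ, EB) ∞ B]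
  [TopologicalSpace F] [ChartedSpace EF F] [IsManifold 𝓘(ℝ, EF) ∞ F]
  {π : M → B} {ξ : CoorientedField EM M} {α : ∀ m : M, TangentSpace 𝓘(ℝ, EM) m →L[ℝ] ℝ}
  {γ : ℝ → B} {a b : ℝ}

/-- Horizontal lifts of `γ` over an arbitrary set of times. -/
def IsHorizontalLiftOn (π : M → B) (H : ∀ m : M, Submodule ℝ (TangentSpace 𝓘(ℝ, EM) m))
    (γ : ℝ → B) (I : Set ℝ) (c : ℝ → M) : Prop :=
  ∀ t ∈ I, π (c t) = γ t ∧ ∃ v ∈ H (c t),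
    HasMFDerivWithinAt 𝓘(ℝ, ℝ) 𝓘(ℝ, EM) c I t ((1 : ℝ →L[ℝ] ℝ).smulRight v)

theorem IsHorizontalLiftOn.mono {H : ∀ m : M, Submodule ℝ (TangentSpace 𝓘(ℝ, EM) m)}
    {I J : Set ℝ} {c : ℝ → M} (hc : IsHorizontalLiftOn π H γ I c) (hJ : J ⊆ I) :
    IsHorizontalLiftOn π H γ J c := fun t ht ↦ by
  obtain ⟨h, v, hv, hd⟩ := hc t (hJ ht)
  exact ⟨h, v, hv, hd.mono hJ⟩

theorem IsHorizontalLiftOn.continuousOn {H : ∀ m : M, Submodule ℝ (TangentSpace 𝓘(ℝ, EM) m)}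
    {I : Set ℝ} {c : ℝ → M} (hc : IsHorizontalLiftOn π H γ I c) : ContinuousOn c I := fun t ht ↦ by
  obtain ⟨-, v, -, hd⟩ := hc t ht
  exact hd.continuousWithinAt

theorem AdaptedChart.hasDerivWithinAt_base (ch : AdaptedChart EM EB EF π) (hab : a < b)
    (hγ : ContMDiffOn 𝓘(ℝ, ℝ) 𝓘(ℝ, EB) ∞ γ (Icc a b)) {t : ℝ} (ht : t ∈ Icc a b)
    (hs : γ t ∈ ch.base.source) :
    HasDerivWithinAt (ch.base ∘ γ) (derivWithin (ch.base ∘ γ) (Icc a b) t) (Icc a b) t ∧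
      ContinuousWithinAt (derivWithin (ch.base ∘ γ) (Icc a b)) (Icc a b) t := by
  have h : ContDiffWithinAt ℝ ∞ (ch.base ∘ γ) (Icc a b) t :=
    contMDiffWithinAt_iff_contDiffWithinAt.1 (ContMDiffAt.comp_contMDiffWithinAt t
      (ch.contMDiffOn_base.contMDiffAt (ch.base.open_source.mem_nhds hs)) (hγ t ht))
  exact ⟨(h.differentiableWithinAt (by simp)).hasDerivWithinAt,
    (h.derivWithin (m := ∞) (uniqueDiffOn_Icc hab) (by simp) ht).continuousWithinAt⟩

theorem AdaptedChart.total_lift (ch : AdaptedChart EM EB EF π) {c : ℝ → M} {t : ℝ}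
    (hc : π (c t) = γ t) (hs : c t ∈ ch.total.source) :
    ch.total (c t) = ((ch.base ∘ γ) t, (ch.total (c t)).2) :=
  Prod.ext ((ch.fst_total _ hs).trans (congrArg ch.base hc)) rfl

/-- In an adapted chart, horizontal lifts solve an ordinary differential equation. -/
theorem AdaptedChart.hasDerivWithinAt_lift (ch : AdaptedChart EM EB EF π)
    (hπ : IsSmoothFiberBundle EM EB EF F π) (hξ : IsContactOnFibers EB EF F π ξ)
    (hα : ξ.IsKernelForm α) {X : EB × EF → EB →L[ℝ] EF}
    (hX : ∀ x ∈ ch.total.target, IsHorizontalAt (formInCoord α ch.total.symm) x (X x))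
    (hab : a < b) {c : ℝ → M}
    (hc : IsHorizontalLiftOn π (contactConnection EB π ξ α) γ (Icc a b) c) {t : ℝ}
    (ht : t ∈ Icc a b) (hs : c t ∈ ch.total.source) {p : EB}
    (hp : HasDerivWithinAt (ch.base ∘ γ) p (Icc a b) t) :
    HasDerivWithinAt (fun τ ↦ (ch.total (c τ)).2)
      (X ((ch.base ∘ γ) t, (ch.total (c t)).2) p) (Icc a b) t := by
  obtain ⟨hct, v, hv, hd⟩ := hc t ht
  have hev : ∀ᶠ τ in 𝓝[Icc a b] t, c τ ∈ ch.total.source ∧ π (c τ) = γ τ :=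
    (hd.continuousWithinAt.eventually_mem (ch.total.open_source.mem_nhds hs)).and
      (Filter.eventually_of_mem self_mem_nhdsWithin fun τ hτ ↦ (hc τ hτ).1)
  let z : EB × EF := mfderiv 𝓘(ℝ, EM) 𝓘(ℝ, EB × EF) ch.total (c t) v
  have h₁ := HasMFDerivAt.comp_hasMFDerivWithinAt t
    (ch.mdifferentiableAt_total hs).hasMFDerivAt hd
  let T : EM →L[ℝ] EB × EF := mfderiv 𝓘(ℝ, EM) 𝓘(ℝ, EB × EF) ch.total (c t)
  have h₁' : HasFDerivWithinAt (ch.total ∘ c) (T.comp ((1 : ℝ →L[ℝ] ℝ).smulRight (v : EM)))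
    (Icc a b) t := hasMFDerivWithinAt_iff_hasFDerivWithinAt.1 h₁
  have h₂ : HasDerivWithinAt (ch.total ∘ c) z (Icc a b) t :=
    h₁'.hasDerivWithinAt.congr_deriv (congrArg T (one_smul ℝ (v : EM)))
  have h₃ : HasDerivWithinAt (ch.base ∘ γ) z.1 (Icc a b) t := by
    have h₄ : HasDerivWithinAt (fun τ ↦ ((ch.total ∘ c) τ).1) z.1 (Icc a b) t :=
      ((hasFDerivAt_fst (𝕜 := ℝ) (E := EB) (F := EF)).comp_hasDerivWithinAt t h₂)
    refine h₄.congr_of_eventuallyEq ?_ ?_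
    · filter_upwards [hev] with τ hτ
      exact (congrArg Prod.fst (ch.total_lift hτ.2 hτ.1)).symm
    · exact (congrArg Prod.fst (ch.total_lift hct hs)).symm
  have hz₁ : z.1 = p := (uniqueDiffOn_Icc hab t ht).eq_deriv _ h₃ hp
  have hz₂ : z.2 = X (ch.total (c t)) z.1 := by
    have hx := ch.total.map_source hs
    rw [← ch.frame_mem_contactConnection_iff hπ hξ hα hx (hX _ hx)]
    have h₅ : ∀ m, m = c t → ∀ u : EM, u = v → u ∈ contactConnection EB π ξ α m := by
      rintro _ rfl _ rfl; exact hv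
    exact h₅ _ (ch.total.left_inv hs) _ (ch.frame_mfderiv_total hs v)
  rw [← ch.total_lift hct hs, ← hz₁, ← hz₂]
  exact (hasFDerivAt_snd (𝕜 := ℝ) (E := EB) (F := EF)).comp_hasDerivWithinAt t h₂

/-- Conversely, solutions of the differential equation of `AdaptedChart.hasDerivWithinAt_lift` give
horizontal lifts. -/
theorem AdaptedChart.isHorizontalLiftOn_symm (ch : AdaptedChart EM EB EF π)
    (hπ : IsSmoothFiberBundle EM EB EF F π) (hξ : IsContactOnFibers EB EF F π ξ)
    (hα : ξ.IsKernelForm α) {X : EB × EF → EB →L[ℝ] EF}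
    (hX : ∀ x ∈ ch.total.target, IsHorizontalAt (formInCoord α ch.total.symm) x (X x))
    {I : Set ℝ} {p : ℝ → EB} (hp : ∀ t ∈ I, HasDerivWithinAt (ch.base ∘ γ) (p t) I t)
    (hγ : ∀ t ∈ I, γ t ∈ ch.base.source) {u : ℝ → EF}
    (hu : ∀ t ∈ I, ((ch.base ∘ γ) t, u t) ∈ ch.total.target ∧
      HasDerivWithinAt u (X ((ch.base ∘ γ) t, u t) (p t)) I t) :
    IsHorizontalLiftOn π (contactConnection EB π ξ α) γ I
      (fun t ↦ ch.total.symm ((ch.base ∘ γ) t, u t)) := fun t ht ↦ by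
  obtain ⟨hx, hd⟩ := hu t ht
  refine ⟨(ch.proj_symm hx).2.trans (ch.base.left_inv (hγ t ht)),
    ch.frame _ (p t, X ((ch.base ∘ γ) t, u t) (p t)),
    (ch.frame_mem_contactConnection_iff hπ hξ hα hx (hX _ hx) _).2 rfl, ?_⟩
  set w : EB × EF := (p t, X ((ch.base ∘ γ) t, u t) (p t)) with hw
  have h₁ : HasFDerivWithinAt (fun t ↦ ((ch.base ∘ γ) t, u t)) ((1 : ℝ →L[ℝ] ℝ).smulRight w) I t :=
    ((hp t ht).prodMk hd).hasFDerivWithinAt.congr_fderiv (by ext <;> simp [hw])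
  have h₂ := HasMFDerivAt.comp_hasMFDerivWithinAt t (ch.mdifferentiableAt_symm hx).hasMFDerivAt
    (hasMFDerivWithinAt_iff_hasFDerivWithinAt.2 h₁)
  have h₃ : (ch.frame ((ch.base ∘ γ) t, u t)).comp ((1 : ℝ →L[ℝ] ℝ).smulRight w) =
      (1 : ℝ →L[ℝ] ℝ).smulRight (ch.frame ((ch.base ∘ γ) t, u t) w) := by
    ext; simp
  have h₄ : ∀ T : ℝ →L[ℝ] EM,
      (ch.frame ((ch.base ∘ γ) t, u t)).comp ((1 : ℝ →L[ℝ] ℝ).smulRight w) = T →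
      HasMFDerivWithinAt 𝓘(ℝ, ℝ) 𝓘(ℝ, EM) (fun t ↦ ch.total.symm ((ch.base ∘ γ) t, u t)) I t T := by
    rintro _ rfl
    exact h₂
  exact h₄ _ h₃

/-- Two horizontal lifts that agree at one time agree nearby, by Gronwall's inequality. -/
theorem IsHorizontalLiftOn.eventuallyEq (hπ : IsSmoothFiberBundle EM EB EF F π)
    (hξ : IsContactOnFibers EB EF F π ξ) (hα : ξ.IsKernelForm α) (hab : a < b)
    (hγ : ContMDiffOn 𝓘(ℝ, ℝ) 𝓘(ℝ, EB) ∞ γ (Icc a b)) {c₁ c₂ : ℝ → M}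
    (h₁ : IsHorizontalLiftOn π (contactConnection EB π ξ α) γ (Icc a b) c₁)
    (h₂ : IsHorizontalLiftOn π (contactConnection EB π ξ α) γ (Icc a b) c₂)
    {t₀ : ℝ} (ht₀ : t₀ ∈ Icc a b) (heq : c₁ t₀ = c₂ t₀) :
    ∀ᶠ t in 𝓝[Icc a b] t₀, c₁ t = c₂ t := by
  obtain ⟨ch, hch⟩ := hπ.exists_adaptedChart (c₁ t₀)
  obtain ⟨X, R, hXs, -, hXR⟩ := (ch.isFiberContactForm hπ hξ hα).exists_horizontal
  have hX := fun x hx ↦ (hXR x hx).1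
  set q := ch.base ∘ γ with hq
  let p := derivWithin q (Icc a b)
  have hbase : ∀ c, IsHorizontalLiftOn π (contactConnection EB π ξ α) γ (Icc a b) c → ∀ t ∈ Icc a b,
      c t ∈ ch.total.source → γ t ∈ ch.base.source := fun c hc t ht hs ↦
    (hc t ht).1 ▸ ch.proj_mem _ hs
  have hp₀ := (ch.hasDerivWithinAt_base hab hγ ht₀ (hbase _ h₁ t₀ ht₀ hch)).2
  obtain ⟨K, W, hW, hlip⟩ := ((hXs.contDiffAt (ch.total.open_target.mem_nhds
    (ch.total.map_source hch))).of_le (n := ∞) (m := 1) (by simp)).exists_lipschitzOnWith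
  let P : NNReal := ‖p t₀‖₊ + 1
  have hP : ∀ᶠ t in 𝓝[Icc a b] t₀, ‖p t‖₊ ≤ P := by
    have h : ‖p t₀‖₊ < P := lt_add_one _
    exact (hp₀.nnnorm.eventually (gt_mem_nhds h)).mono fun t ht ↦ le_of_lt ht
  have hev : ∀ c, IsHorizontalLiftOn π (contactConnection EB π ξ α) γ (Icc a b) c → c t₀ = c₁ t₀ →
      ∀ᶠ t in 𝓝[Icc a b] t₀, c t ∈ ch.total.source ∧ ch.total (c t) ∈ W := by
    intro c hc hc₀
    have hcc := hc.continuousOn t₀ ht₀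
    rw [← hc₀] at hch hW
    exact (hcc.eventually_mem (ch.total.open_source.mem_nhds hch)).and
      (((ch.total.continuousAt hch).comp_continuousWithinAt hcc).eventually_mem hW)
  obtain ⟨a', b', hab', -, hsub, hmem, ht₀', hQ⟩ := exists_Icc_of_eventually hab ht₀
    (((hev c₁ h₁ rfl).and (hev c₂ h₂ heq.symm)).and hP) one_pos
  let y : (ℝ → M) → ℝ → EF := fun c t ↦ (ch.total (c t)).2
  let f : ℝ → EF → EF := fun t z ↦ X (q t, z) (p t)
  let S : ℝ → Set EF := fun t ↦ {z | (q t, z) ∈ W}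
  have hlipf : ∀ t ∈ Icc a' b', LipschitzOnWith (K * P) (f t) (S t) := by
    intro t ht
    refine LipschitzOnWith.of_dist_le_mul fun z hz z' hz' ↦ ?_
    have e₁ := hlip.dist_le_mul _ hz _ hz'
    have e₂ : dist (q t, z) (q t, z') = dist z z' := by simp [Prod.dist_eq]
    rw [e₂, dist_eq_norm] at e₁
    rw [dist_eq_norm]
    calc ‖f t z - f t z'‖ = ‖(X (q t, z) - X (q t, z')) (p t)‖ := rfl
      _ ≤ ‖X (q t, z) - X (q t, z')‖ * ‖p t‖ := ContinuousLinearMap.le_opNorm _ _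
      _ ≤ (K * dist z z') * P := by
          gcongr
          exact (hQ t ht).2
      _ = _ := by push_cast; ring
  have hder : ∀ c, IsHorizontalLiftOn π (contactConnection EB π ξ α) γ (Icc a b) c →
      (∀ t ∈ Icc a' b', c t ∈ ch.total.source ∧ ch.total (c t) ∈ W) →
      (∀ t ∈ Icc a' b', HasDerivWithinAt (y c) (f t (y c t)) (Icc a' b') t) ∧
        ∀ t ∈ Icc a' b', y c t ∈ S t := by
    refine fun c hc hcW ↦ ⟨fun t ht ↦ ?_, fun t ht ↦ ?_⟩
    · exact (ch.hasDerivWithinAt_lift hπ hξ hα hX hab hc (hsub ht) (hcW t ht).1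
        (ch.hasDerivWithinAt_base hab hγ (hsub ht)
          (hbase c hc t (hsub ht) (hcW t ht).1)).1).mono hsub
    · have := (hcW t ht).2
      rw [ch.total_lift (hc t (hsub ht)).1 (hcW t ht).1] at this
      exact this
  obtain ⟨d₁, m₁⟩ := hder c₁ h₁ fun t ht ↦ (hQ t ht).1.1
  obtain ⟨d₂, m₂⟩ := hder c₂ h₂ fun t ht ↦ (hQ t ht).1.2
  have hcont : ∀ c, (∀ t ∈ Icc a' b', HasDerivWithinAt (y c) (f t (y c t)) (Icc a' b') t) →
    ContinuousOn (y c) (Icc a' b') := fun c hc t ht ↦ (hc t ht).continuousWithinAt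
  have hy₀ : y c₁ t₀ = y c₂ t₀ := by simp only [y, heq]
  have hR : EqOn (y c₁) (y c₂) (Icc t₀ b') := by
    have hs₁ : Icc t₀ b' ⊆ Icc a' b' := Icc_subset_Icc_left ht₀'.1
    have hs₂ : Ico t₀ b' ⊆ Icc a' b' := Ico_subset_Icc_self.trans hs₁
    have hright : ∀ c, (∀ t ∈ Icc a' b', HasDerivWithinAt (y c) (f t (y c t)) (Icc a' b') t) →
        ∀ t ∈ Ico t₀ b', HasDerivWithinAt (y c) (f t (y c t)) (Ici t) t := fun c hc t ht ↦
      (hc t (hs₂ ht)).mono_of_mem_nhdsWithin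
        (Filter.mem_of_superset (Icc_mem_nhdsGE ht.2)
          (Icc_subset_Icc_left (ht₀'.1.trans ht.1)))
    exact ODE_solution_unique_of_mem_Icc_right (fun t ht ↦ hlipf t (hs₂ ht))
      ((hcont c₁ d₁).mono hs₁) (hright c₁ d₁) (fun t ht ↦ m₁ t (hs₂ ht))
      ((hcont c₂ d₂).mono hs₁) (hright c₂ d₂) (fun t ht ↦ m₂ t (hs₂ ht)) hy₀
  have hL : EqOn (y c₁) (y c₂) (Icc a' t₀) := by
    have hs₁ : Icc a' t₀ ⊆ Icc a' b' := Icc_subset_Icc_right ht₀'.2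
    have hs₂ : Ioc a' t₀ ⊆ Icc a' b' := Ioc_subset_Icc_self.trans hs₁
    have hleft : ∀ c, (∀ t ∈ Icc a' b', HasDerivWithinAt (y c) (f t (y c t)) (Icc a' b') t) →
        ∀ t ∈ Ioc a' t₀, HasDerivWithinAt (y c) (f t (y c t)) (Iic t) t := fun c hc t ht ↦
      (hc t (hs₂ ht)).mono_of_mem_nhdsWithin
        (Filter.mem_of_superset (Icc_mem_nhdsLE ht.1)
          (Icc_subset_Icc_right (ht.2.trans ht₀'.2)))
    exact ODE_solution_unique_of_mem_Icc_left (fun t ht ↦ hlipf t (hs₂ ht))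
      ((hcont c₁ d₁).mono hs₁) (hleft c₁ d₁) (fun t ht ↦ m₁ t (hs₂ ht))
      ((hcont c₂ d₂).mono hs₁) (hleft c₂ d₂) (fun t ht ↦ m₂ t (hs₂ ht)) hy₀
  filter_upwards [hmem] with t ht
  have hyt : y c₁ t = y c₂ t := by
    rcases le_total t₀ t with h | h
    · exact hR ⟨h, ht.2⟩
    · exact hL ⟨ht.1, h⟩
  have ht' := hsub ht
  refine ch.total.injOn (hQ t ht).1.1.1 (hQ t ht).1.2.1 ?_
  rw [ch.total_lift (h₁ t ht').1 (hQ t ht).1.1.1, ch.total_lift (h₂ t ht').1 (hQ t ht).1.2.1]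
  exact Prod.ext rfl hyt

/-- Horizontal lifts over an interval are determined by their value at one time. -/
theorem IsHorizontalLiftOn.eqOn [T2Space M] (hπ : IsSmoothFiberBundle EM EB EF F π)
    (hξ : IsContactOnFibers EB EF F π ξ) (hα : ξ.IsKernelForm α) (hab : a < b)
    (hγ : ContMDiffOn 𝓘(ℝ, ℝ) 𝓘(ℝ, EB) ∞ γ (Icc a b)) {c₁ c₂ : ℝ → M}
    (h₁ : IsHorizontalLiftOn π (contactConnection EB π ξ α) γ (Icc a b) c₁)
    (h₂ : IsHorizontalLiftOn π (contactConnection EB π ξ α) γ (Icc a b) c₂)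
    {t₀ : ℝ} (ht₀ : t₀ ∈ Icc a b) (heq : c₁ t₀ = c₂ t₀) : EqOn c₁ c₂ (Icc a b) := by
  intro t ht
  refine forall_Icc_of_locally_constant (P := fun t ↦ c₁ t = c₂ t) (fun τ hτ ↦ ?_) ht₀ ht heq
  by_cases h : c₁ τ = c₂ τ
  · exact ⟨_, h₁.eventuallyEq hπ hξ hα hab hγ h₂ hτ h, fun _ _ _ hs _ ↦ hs.1⟩
  · refine ⟨{t | c₁ t ≠ c₂ t}, ?_, fun s hs _ _ hs' ↦ absurd hs' hs.1⟩
    exact (((h₁.continuousOn τ hτ).prodMk (h₂.continuousOn τ hτ)).eventually_mem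
      (isOpen_ne_fun continuous_fst continuous_snd |>.mem_nhds h))

end HorizontalLifts

/-! ### Parallel transport over short times -/

section LocalTransport

variable {EM EB EF : Type*} [NormedAddCommGroup EM] [NormedSpace ℝ EM] [FiniteDimensional ℝ EM]
  [NormedAddCommGroup EB] [NormedSpace ℝ EB] [FiniteDimensional ℝ EB]
  [NormedAddCommGroup EF] [NormedSpace ℝ EF] [FiniteDimensional ℝ EF]
  {M B F : Type*} [TopologicalSpace M] [T2Space M] [ChartedSpace EM M] [IsManifold 𝓘(ℝ, EM) ∞ M]
  [TopologicalSpace B] [ChartedSpace EB B] [IsManifold 𝓘(ℝ, EB) ∞ B]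
  [TopologicalSpace F] [ChartedSpace EF F] [IsManifold 𝓘(ℝ, EF) ∞ F]
  {π : M → B} {ξ : CoorientedField EM M} {α : ∀ m : M, TangentSpace 𝓘(ℝ, EM) m →L[ℝ] ℝ}
  {γ : ℝ → B}

/-- Around a horizontal lift `c` of `γ`, parallel transport between nearby times `s` and `t` extends
to a smooth map of the total space, which rescales the restriction of `α` to the vertical space at
`c s` by a positive factor. -/
theorem IsHorizontalLift.exists_local_transport (hπ : IsSmoothFiberBundle EM EB EF F π)
    (hξ : IsContactOnFibers EB EF F π ξ) (hα : ξ.IsKernelForm α)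
    (hγ : ContMDiffOn 𝓘(ℝ, ℝ) 𝓘(ℝ, EB) ∞ γ (Icc 0 1)) {c : ℝ → M}
    (hc : IsHorizontalLift π (contactConnection EB π ξ α) γ c) {t₀ : ℝ} (ht₀ : t₀ ∈ Icc (0 : ℝ) 1) :
    ∃ W ∈ 𝓝[Icc 0 1] t₀, ∀ s ∈ W ∩ Icc 0 1, ∀ t ∈ W ∩ Icc 0 1, ∃ Ψ : M → M,
      ContMDiffAt 𝓘(ℝ, EM) 𝓘(ℝ, EM) ∞ Ψ (c s) ∧
      (∀ᶠ m in 𝓝 (c s), ∀ c' : ℝ → M,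
        IsHorizontalLift π (contactConnection EB π ξ α) γ c' → c' s = m → c' t = Ψ m) ∧
      ∃ g : ℝ, 0 < g ∧ ∀ w ∈ vertical EM EB π (c s),
        α (Ψ (c s)) (mfderiv 𝓘(ℝ, EM) 𝓘(ℝ, EM) Ψ (c s) w) = g * α (c s) w := by
  have hc' : IsHorizontalLiftOn π (contactConnection EB π ξ α) γ (Icc 0 1) c := hc
  obtain ⟨ch, hch⟩ := hπ.exists_adaptedChart (c t₀)
  have hform := ch.isFiberContactForm hπ hξ hα
  obtain ⟨X, R, hXs, hR, hXR⟩ := hform.exists_horizontal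
  have hX := fun x hx ↦ (hXR x hx).1
  set q := ch.base ∘ γ with hq
  let p := derivWithin q (Icc 0 1)
  have hbase : ∀ t ∈ Icc (0 : ℝ) 1, c t ∈ ch.total.source → γ t ∈ ch.base.source :=
    fun t ht hs ↦ (hc t ht).1 ▸ ch.proj_mem _ hs
  have hp : ∀ t ∈ Icc (0 : ℝ) 1, c t ∈ ch.total.source →
      HasDerivWithinAt q (p t) (Icc 0 1) t ∧ ContinuousWithinAt p (Icc 0 1) t :=
    fun t ht hs ↦ ch.hasDerivWithinAt_base one_pos hγ ht (hbase t ht hs)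
  let ρ : ℝ → ℝ := fun t ↦ ‖fderiv ℝ X (ch.total (c t))‖ * ‖p t‖
  have hcc := hc'.continuousOn t₀ ht₀
  have hρ : ContinuousWithinAt ρ (Icc 0 1) t₀ := by
    have h₁ : ContinuousAt (fderiv ℝ X) (ch.total (c t₀)) :=
      (hXs.continuousOn_fderiv_of_isOpen ch.total.open_target (by simp)).continuousAt
        (ch.total.open_target.mem_nhds (ch.total.map_source hch))
    have h₂ := (ch.total.continuousAt hch).comp_continuousWithinAt hcc
    have h₃ : ContinuousWithinAt (fun t ↦ ‖fderiv ℝ X (ch.total (c t))‖) (Icc 0 1) t₀ :=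
      ContinuousAt.comp_continuousWithinAt (f := ch.total ∘ c) (g := fun x ↦ ‖fderiv ℝ X x‖)
        (ContinuousAt.comp (f := fderiv ℝ X) (g := fun T ↦ ‖T‖)
          (continuous_norm (E := EB × EF →L[ℝ] EB →L[ℝ] EF)).continuousAt h₁) h₂
    exact h₃.mul (hp t₀ ht₀ hch).2.norm
  -- a bound for `ρ` near `t₀`; the interval is then taken shorter than `1 / C`, as the local flow
  -- requires
  let C : ℝ := ρ t₀ + 1
  have hC : 0 < C := by positivity
  obtain ⟨a, b, hab, hlen, hsub, hmem, -, hQ⟩ := exists_Icc_of_eventually one_pos ht₀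
    ((hcc.eventually_mem (ch.total.open_source.mem_nhds hch)).and
      (hρ.eventually (gt_mem_nhds (lt_add_one (ρ t₀))))) (one_div_pos.2 hC)
  have hlen' : (b - a) * C < 1 := (lt_div_iff₀ hC).1 hlen
  refine ⟨Icc a b, hmem, ?_⟩
  rintro s ⟨hs, -⟩ t ⟨ht, -⟩
  let y : ℝ → EF := fun τ ↦ (ch.total (c τ)).2
  have htot : ∀ τ ∈ Icc a b, ch.total (c τ) = (q τ, y τ) := fun τ hτ ↦
    ch.total_lift (hc τ (hsub hτ)).1 (hQ τ hτ).1
  have hyU : ∀ τ ∈ Icc a b, (q τ, y τ) ∈ ch.total.target := fun τ hτ ↦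
    htot τ hτ ▸ ch.total.map_source (hQ τ hτ).1
  have hqd : ∀ τ ∈ Icc a b, HasDerivWithinAt q (p τ) (Icc a b) τ := fun τ hτ ↦
    (hp τ (hsub hτ) (hQ τ hτ).1).1.mono hsub
  have hpc : ContinuousOn p (Icc a b) := fun τ hτ ↦ (hp τ (hsub hτ) (hQ τ hτ).1).2.mono hsub
  have hy : ∀ τ ∈ Icc a b, HasDerivWithinAt y (X (q τ, y τ) (p τ)) (Icc a b) τ := fun τ hτ ↦
    ch.hasDerivWithinAt_lift hπ hξ hα hX hab (hc'.mono hsub) hτ (hQ τ hτ).1 (hqd τ hτ)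
  have : CompleteSpace EF := FiniteDimensional.complete ℝ EF
  obtain ⟨u, hu, huy, hus, huj⟩ := exists_localFlow hab.le ch.total.open_target hXs
    (fun τ hτ ↦ (hqd τ hτ).continuousWithinAt) hpc hyU hy (C := C)
    (fun τ hτ ↦ by rw [← htot τ hτ]; exact (hQ τ hτ).2.le) hlen' hs
  obtain ⟨g, hg, hgj⟩ := hform.exists_pos_scaling hXs hR hXR hab.le hpc hqd hyU hy hs ht
  have hsrc := (hQ s hs).1
  -- the transport, as a map of the model space
  let k : EB × EF → EB × EF := fun x ↦ (q t, u x.2 t)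
  have hks : k (ch.total (c s)) = (q t, y t) := Prod.ext rfl (huy t ht)
  have hkd : ContDiffAt ℝ ∞ k (ch.total (c s)) :=
    contDiffAt_const.prodMk ((hus t ht).comp (ch.total (c s)) contDiff_snd.contDiffAt)
  have hkt : k (ch.total (c s)) ∈ ch.total.target := hks ▸ hyU t ht
  refine ⟨fun m ↦ ch.total.symm (k (ch.total m)), ?_, ?_, g, hg, ?_⟩
  · have h₁ : ContMDiffAt 𝓘(ℝ, EM) 𝓘(ℝ, EB × EF) ∞ (fun m ↦ k (ch.total m)) (c s) :=
      ContMDiffAt.comp (g := k) (f := ch.total) (c s) hkd.contMDiffAt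
        (ch.contMDiffOn_total.contMDiffAt (ch.total.open_source.mem_nhds hsrc))
    exact ContMDiffAt.comp (g := ch.total.symm) (f := fun m ↦ k (ch.total m)) (c s)
      (ch.contMDiffOn_total_symm.contMDiffAt (ch.total.open_target.mem_nhds hkt)) h₁
  · have h₁ : Filter.Tendsto (fun m ↦ (ch.total m).2) (𝓝 (c s)) (𝓝 (y s)) :=
      (continuous_snd.continuousAt.comp (ch.total.continuousAt hsrc)).tendsto
    filter_upwards [ch.total.open_source.mem_nhds hsrc, h₁.eventually hu] with m hm hum c' hc₁ hcs
    have hc₂ : IsHorizontalLiftOn π (contactConnection EB π ξ α) γ (Icc 0 1) c' := hc₁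
    have hlift : IsHorizontalLiftOn π (contactConnection EB π ξ α) γ (Icc a b)
        (fun τ ↦ ch.total.symm (q τ, u (ch.total m).2 τ)) :=
      ch.isHorizontalLiftOn_symm hπ hξ hα hX hqd
        (fun τ hτ ↦ hbase τ (hsub hτ) (hQ τ hτ).1) hum.2
    have hmt : ch.total m = (q s, (ch.total m).2) :=
      ch.total_lift (γ := γ) (c := fun _ ↦ m) (hcs ▸ (hc₁ s (hsub hs)).1) hm
    refine (hc₂.mono hsub).eqOn hπ hξ hα hab (hγ.mono hsub) hlift hs ?_ ht
    rw [hum.1, ← hmt, ch.total.left_inv hm, hcs]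
  · intro w hw
    let D : EF →L[ℝ] EF := fderiv ℝ (fun z ↦ u z t) (y s)
    have hDu : HasFDerivAt (fun z ↦ u z t) D (ch.total (c s)).2 :=
      ((hus t ht).differentiableAt (by simp)).hasFDerivAt
    have hkd' : HasFDerivAt k ((0 : EB × EF →L[ℝ] EB).prod
        (D.comp (ContinuousLinearMap.snd ℝ EB EF))) (ch.total (c s)) :=
      (hasFDerivAt_const (q t) _).prodMk
        (HasFDerivAt.comp (g := fun z ↦ u z t) (f := Prod.snd) (ch.total (c s)) hDu hasFDerivAt_snd)
    have h₁ := HasMFDerivAt.comp (c s) (hasMFDerivAt_iff_hasFDerivAt.2 hkd')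
      (ch.mdifferentiableAt_total hsrc).hasMFDerivAt
    have h₂ := (HasMFDerivAt.comp (c s) (ch.mdifferentiableAt_symm hkt).hasMFDerivAt h₁).mfderiv
    let z : EB × EF := mfderiv 𝓘(ℝ, EM) 𝓘(ℝ, EB × EF) ch.total (c s) w
    have hxs := ch.total.map_source hsrc
    have hzw : ch.frame (ch.total (c s)) z = w := ch.frame_mfderiv_total hsrc w
    have hz₁ : z.1 = 0 := by
      rw [← ch.frame_mem_vertical_iff hπ.contMDiff hxs z]
      have h₅ : ∀ m, m = c s → ∀ u : EM, u = w → u ∈ vertical EM EB π m := by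
        rintro _ rfl _ rfl; exact hw
      exact h₅ _ (ch.total.left_inv hsrc) _ hzw
    have hz : z = (0, z.2) := Prod.ext hz₁ rfl
    have e₁ : α (c s) w = formInCoord α ch.total.symm (q s, y s) (0, z.2) := by
      have h₅ : ∀ m, m = c s → ∀ u : EM, u = w → α (c s) w = α m u := by
        rintro _ rfl _ rfl; rfl
      rw [← hz, ← htot s hs]
      exact h₅ _ (ch.total.left_inv hsrc) _ hzw
    have hj := huj z.2
    have e₂ := hgj (fun τ ↦ fderiv ℝ (fun z ↦ u z τ) (y s) z.2) fun τ hτ ↦ hj.2 τ hτ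
    rw [hj.1] at e₂
    rw [e₁, ← e₂]
    refine (congrArg (α _) (DFunLike.congr_fun h₂ w)).trans ?_
    rw [← hks]
    rfl

end LocalTransport

/-! ### Global parallel transport -/

section GlobalTransport

variable {EM EB EF : Type*} [NormedAddCommGroup EM] [NormedSpace ℝ EM] [FiniteDimensional ℝ EM]
  [NormedAddCommGroup EB] [NormedSpace ℝ EB] [FiniteDimensional ℝ EB]
  [NormedAddCommGroup EF] [NormedSpace ℝ EF] [FiniteDimensional ℝ EF]
  {M B F : Type*} [TopologicalSpace M] [T2Space M] [ChartedSpace EM M] [IsManifold 𝓘(ℝ, EM) ∞ M]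
  [TopologicalSpace B] [ChartedSpace EB B] [IsManifold 𝓘(ℝ, EB) ∞ B]
  [TopologicalSpace F] [ChartedSpace EF F] [IsManifold 𝓘(ℝ, EF) ∞ F]
  {π : M → B} {ξ : CoorientedField EM M} {α : ∀ m : M, TangentSpace 𝓘(ℝ, EM) m →L[ℝ] ℝ}
  {γ : ℝ → B}

/-- Two horizontal lifts over the unit interval that agree at one time are equal. -/
theorem IsHorizontalLift.apply_eq (hπ : IsSmoothFiberBundle EM EB EF F π)
    (hξ : IsContactOnFibers EB EF F π ξ) (hα : ξ.IsKernelForm α)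
    (hγ : ContMDiffOn 𝓘(ℝ, ℝ) 𝓘(ℝ, EB) ∞ γ (Icc 0 1)) {c₁ c₂ : ℝ → M}
    (h₁ : IsHorizontalLift π (contactConnection EB π ξ α) γ c₁)
    (h₂ : IsHorizontalLift π (contactConnection EB π ξ α) γ c₂) {s t : ℝ}
    (hs : s ∈ Icc (0 : ℝ) 1) (ht : t ∈ Icc (0 : ℝ) 1) (heq : c₁ s = c₂ s) : c₁ t = c₂ t := by
  have h₁' : IsHorizontalLiftOn π (contactConnection EB π ξ α) γ (Icc 0 1) c₁ := h₁
  have h₂' : IsHorizontalLiftOn π (contactConnection EB π ξ α) γ (Icc 0 1) c₂ := h₂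
  exact h₁'.eqOn hπ hξ hα one_pos hγ h₂' hs heq ht

/-- The state of a parallel transport `G : F → M` along fibres, starting from the parametrization
`ι`, at the point `f`: it is smooth with injective differential and rescales `ι^*α` by a positive
factor. -/
def IsConformalAt (α : ∀ m : M, TangentSpace 𝓘(ℝ, EM) m →L[ℝ] ℝ) (ι G : F → M) (f : F) : Prop :=
  ContMDiffAt 𝓘(ℝ, EF) 𝓘(ℝ, EM) ∞ G f ∧
    Function.Injective (mfderiv 𝓘(ℝ, EF) 𝓘(ℝ, EM) G f) ∧
    ∃ g : ℝ, 0 < g ∧ ∀ w, α (G f) (mfderiv 𝓘(ℝ, EF) 𝓘(ℝ, EM) G f w) =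
      g * α (ι f) (mfderiv 𝓘(ℝ, EF) 𝓘(ℝ, EM) ι f w)

/-- Parallel transport is conformal at all times: it is so at time `0`, and the local transports
carry this property from any time to all nearby times. -/
theorem IsParallelTransportOn.isConformalAt (hπ : IsSmoothFiberBundle EM EB EF F π)
    (hξ : IsContactOnFibers EB EF F π ξ) (hα : ξ.IsKernelForm α)
    (hγ : ContMDiffOn 𝓘(ℝ, ℝ) 𝓘(ℝ, EB) ∞ γ (Icc 0 1)) {O : Set M} {P : ℝ → M → M} (hO : IsOpen O)
    (hP : IsParallelTransportOn π (contactConnection EB π ξ α) γ (O ∩ π ⁻¹' {γ 0}) P)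
    {e : SmoothTrivialization EM EB EF F π} (he : γ 0 ∈ e.baseSet) {f : F}
    (hf : e.param (γ 0) f ∈ O) {t : ℝ} (ht : t ∈ Icc (0 : ℝ) 1) :
    IsConformalAt (EF := EF) α (e.param (γ 0)) (fun f ↦ P t (e.param (γ 0) f)) f := by
  set ι := e.param (γ 0) with hι_def
  have hι : ContMDiff 𝓘(ℝ, EF) 𝓘(ℝ, EM) ∞ ι := e.contMDiff_param he
  let G : ℝ → F → M := fun t f ↦ P t (ι f)
  have hO' : ∀ᶠ f' in 𝓝 f, ι f' ∈ O :=
    hι.continuous.continuousAt.eventually_mem (hO.mem_nhds hf)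
  have hPι : ∀ f', ι f' ∈ O → G 0 f' = ι f' ∧
      IsHorizontalLift π (contactConnection EB π ξ α) γ (fun t ↦ G t f') := fun f' hf' ↦
    hP _ ⟨hf', e.proj_param he f'⟩
  have hlift := (hPι f hf).2
  have h0 : IsConformalAt (EF := EF) α ι (G 0) f := by
    have hG0 : G 0 =ᶠ[𝓝 f] ι := hO'.mono fun f' hf' ↦ (hPι f' hf').1
    refine ⟨(hι f).congr_of_eventuallyEq hG0, ?_, 1, one_pos, fun w ↦ ?_⟩
    · rw [hG0.mfderiv_eq]
      have h₁ := mfderiv_comp f ((e.contMDiffAt_coord (m := ι f)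
        (by rw [e.proj_param he]; exact he)).mdifferentiableAt (by simp))
        ((hι f).mdifferentiableAt (by simp))
      have h₂ : e.coord ∘ ι = id := funext fun f ↦ e.coord_param he f
      rw [h₂, mfderiv_id] at h₁
      intro w w' hw
      exact (DFunLike.congr_fun h₁ w).trans
        ((congrArg _ hw).trans (DFunLike.congr_fun h₁ w').symm)
    · have h₁ : ∀ m, m = ι f → ∀ T : EF →L[ℝ] EM, α m (T w) = 1 * α (ι f) (T w) := by
        rintro _ rfl T; rw [one_mul]
      rw [hG0.mfderiv_eq]
      exact h₁ _ (hPι f hf).1 _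
  refine forall_Icc_of_locally_constant (P := fun t ↦ IsConformalAt (EF := EF) α ι (G t) f)
    (fun t₀ ht₀ ↦ ?_) (left_mem_Icc.2 zero_le_one) ht h0
  obtain ⟨W, hW, hW'⟩ := hlift.exists_local_transport hπ hξ hα hγ ht₀
  -- near `f`, the transport to time `t` factors through the transport to a nearby time `s`
  have hfac : ∀ s ∈ W ∩ Icc 0 1, ∀ t ∈ W ∩ Icc 0 1, ContMDiffAt 𝓘(ℝ, EF) 𝓘(ℝ, EM) ∞ (G s) f →
      ∃ Ψ : M → M, ContMDiffAt 𝓘(ℝ, EM) 𝓘(ℝ, EM) ∞ Ψ (G s f) ∧ G t =ᶠ[𝓝 f] Ψ ∘ G s ∧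
        ∃ g : ℝ, 0 < g ∧ ∀ w ∈ vertical EM EB π (G s f),
          α (Ψ (G s f)) (mfderiv 𝓘(ℝ, EM) 𝓘(ℝ, EM) Ψ (G s f) w) = g * α (G s f) w := by
    intro s hs t ht hGs
    obtain ⟨Ψ, hΨ, hΨG, hg⟩ := hW' s hs t ht
    refine ⟨Ψ, hΨ, ?_, hg⟩
    filter_upwards [hGs.continuousAt.eventually hΨG, hO'] with f' h₁ h₂
    exact h₁ _ (hPι f' h₂).2 rfl
  refine ⟨W, hW, ?_⟩
  rintro s hs t ht ⟨hGs, hinj, g, hg, hgα⟩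
  obtain ⟨Ψ, hΨ, hΨG, g', hg', hΨα⟩ := hfac s hs t ht hGs
  have hGt : ContMDiffAt 𝓘(ℝ, EF) 𝓘(ℝ, EM) ∞ (G t) f :=
    (ContMDiffAt.comp f hΨ hGs).congr_of_eventuallyEq hΨG
  have hdt := mfderiv_comp f (hΨ.mdifferentiableAt (by simp)) (hGs.mdifferentiableAt (by simp))
  rw [← hΨG.mfderiv_eq] at hdt
  refine ⟨hGt, ?_, g' * g, mul_pos hg' hg, fun w ↦ ?_⟩
  -- transporting back from `t` to `s` shows that the differential stays injective
  · obtain ⟨Ψ', hΨ', hΨG', -⟩ := hfac t ht s hs hGt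
    have hds := mfderiv_comp f (hΨ'.mdifferentiableAt (by simp))
      (hGt.mdifferentiableAt (by simp))
    rw [← hΨG'.mfderiv_eq] at hds
    intro w w' hw
    refine hinj ((DFunLike.congr_fun hds w).trans
      (Eq.trans ?_ (DFunLike.congr_fun hds w').symm))
    exact congrArg (mfderiv 𝓘(ℝ, EM) 𝓘(ℝ, EM) Ψ' (G t f)) hw
  · have hvert : mfderiv 𝓘(ℝ, EF) 𝓘(ℝ, EM) (G s) f w ∈ vertical EM EB π (G s f) := by
      have h₁ := mfderiv_comp f ((hπ.contMDiff (G s f)).mdifferentiableAt (by simp))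
        (hGs.mdifferentiableAt (by simp))
      have h₂ : π ∘ G s =ᶠ[𝓝 f] fun _ ↦ γ s :=
        hO'.mono fun f' hf' ↦ ((hPι f' hf').2 s hs.2).1
      rw [h₂.mfderiv_eq, mfderiv_const] at h₁
      exact (DFunLike.congr_fun h₁ w).symm
    have h₁ := hΨα _ hvert
    rw [hgα, ← mul_assoc] at h₁
    rw [← h₁]
    have h₂ : ∀ m, m = Ψ (G s f) → ∀ u u' : EM, u = u' → α m u = α (Ψ (G s f)) u' := by
      rintro _ rfl _ _ rfl; rfl
    exact h₂ _ hΨG.eq_of_nhds _ _ (DFunLike.congr_fun hdt w)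

section Fibres

variable (hπ : IsSmoothFiberBundle EM EB EF F π)
    (hξ : IsContactOnFibers EB EF F π ξ) (hα : ξ.IsKernelForm α)
    (hγ : ContMDiffOn 𝓘(ℝ, ℝ) 𝓘(ℝ, EB) ∞ γ (Icc 0 1)) {O : Set M} {P : ℝ → M → M} (hO : IsOpen O)
    (hP : IsParallelTransportOn π (contactConnection EB π ξ α) γ (O ∩ π ⁻¹' {γ 0}) P)
    {t : ℝ} (ht : t ∈ Icc (0 : ℝ) 1)
    {e₀ e₁ : SmoothTrivialization EM EB EF F π} (h₀ : γ 0 ∈ e₀.baseSet) (h₁ : γ t ∈ e₁.baseSet)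

include hP ht h₀ in
theorem IsParallelTransportOn.proj_eq {f : F} (hf : e₀.param (γ 0) f ∈ O) :
    π (P t (e₀.param (γ 0) f)) = γ t :=
  ((hP _ ⟨hf, e₀.proj_param h₀ f⟩).2 t ht).1

include hP ht h₀ h₁ in
/-- The transport recovered from its expression in trivializations. -/
theorem IsParallelTransportOn.param_coord_eq {f : F} (hf : e₀.param (γ 0) f ∈ O) :
    e₁.param (γ t) (e₁.coord (P t (e₀.param (γ 0) f))) = P t (e₀.param (γ 0) f) := by
  have h := hP.proj_eq ht h₀ hf
  rw [← h] at h₁ ⊢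
  exact e₁.param_proj_coord h₁

include hπ hξ hα hγ hO hP ht h₀ h₁ in
theorem IsParallelTransportOn.contMDiffAt_coord {f : F} (hf : e₀.param (γ 0) f ∈ O) :
    ContMDiffAt 𝓘(ℝ, EF) 𝓘(ℝ, EF) ∞ (e₁.coord ∘ P t ∘ e₀.param (γ 0)) f :=
  ContMDiffAt.comp (g := e₁.coord) (f := fun f ↦ P t (e₀.param (γ 0) f)) f
    (e₁.contMDiffAt_coord (by rwa [hP.proj_eq ht h₀ hf]))
    (hP.isConformalAt hπ hξ hα hγ hO h₀ hf ht).1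

include hπ hξ hα hγ hP ht h₀ h₁ in
theorem IsParallelTransportOn.injOn_coord :
    InjOn (e₁.coord ∘ P t ∘ e₀.param (γ 0)) (e₀.param (γ 0) ⁻¹' O) := by
  intro f hf f' hf' heq
  have h₂ : P t (e₀.param (γ 0) f) = P t (e₀.param (γ 0) f') := by
    rw [← hP.param_coord_eq ht h₀ h₁ hf, ← hP.param_coord_eq ht h₀ h₁ hf']
    exact congrArg (e₁.param (γ t)) heq
  have k := hP _ ⟨hf, e₀.proj_param h₀ f⟩
  have k' := hP _ ⟨hf', e₀.proj_param h₀ f'⟩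
  have h₃ := IsHorizontalLift.apply_eq hπ hξ hα hγ k.2 k'.2 ht (left_mem_Icc.2 zero_le_one) h₂
  simp only [k.1, k'.1] at h₃
  rw [← e₀.coord_param h₀ f, h₃, e₀.coord_param h₀]

include hπ hξ hγ hO hP ht h₀ h₁ in
/-- Parallel transport preserves the contact structures of the fibres with their co-orientations.
The differential is onto because it is an injective endomorphism of the model space `EF`. -/
theorem IsParallelTransportOn.preservesOn (hα' : ξ.IsDefinedBy α) :
    PreservesOn (ξ.pullback EF (e₀.param (γ 0))) (ξ.pullback EF (e₁.param (γ t)))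
      (e₁.coord ∘ P t ∘ e₀.param (γ 0)) (e₀.param (γ 0) ⁻¹' O) := by
  intro f hf
  have hα := hα'.1
  set Φ := e₁.coord ∘ P t ∘ e₀.param (γ 0) with hΦ_def
  have hΦ : ContMDiffAt 𝓘(ℝ, EF) 𝓘(ℝ, EF) ∞ Φ f :=
    hP.contMDiffAt_coord hπ hξ hα hγ hO ht h₀ h₁ hf
  obtain ⟨-, hinj, g, hg, hgα⟩ := hP.isConformalAt hπ hξ hα hγ hO h₀ hf ht
  have hG : (fun f ↦ P t (e₀.param (γ 0) f)) =ᶠ[𝓝 f] e₁.param (γ t) ∘ Φ := by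
    filter_upwards [(e₀.contMDiff_param h₀).continuous.continuousAt.eventually_mem
      (hO.mem_nhds hf)] with f' hf'
    exact (hP.param_coord_eq ht h₀ h₁ hf').symm
  have hd := mfderiv_comp f ((e₁.contMDiff_param h₁ (Φ f)).mdifferentiableAt (by simp))
    (hΦ.mdifferentiableAt (by simp))
  rw [← hG.mfderiv_eq] at hd
  let D : EF →L[ℝ] EF := mfderiv 𝓘(ℝ, EF) 𝓘(ℝ, EF) Φ f
  have hDinj : Function.Injective D := fun w w' hw ↦ hinj
    ((DFunLike.congr_fun hd w).trans (Eq.trans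
      (congrArg (mfderiv 𝓘(ℝ, EF) 𝓘(ℝ, EM) (e₁.param (γ t)) (Φ f)) hw)
      (DFunLike.congr_fun hd w').symm))
  have hDsurj : Function.Surjective D := LinearMap.injective_iff_surjective.1 hDinj
  have hαD : ∀ w : EF, α (e₁.param (γ t) (Φ f))
      (mfderiv 𝓘(ℝ, EF) 𝓘(ℝ, EM) (e₁.param (γ t)) (Φ f) (D w)) =
      g * α (e₀.param (γ 0) f) (mfderiv 𝓘(ℝ, EF) 𝓘(ℝ, EM) (e₀.param (γ 0)) f w) := fun w ↦ by
    have h₂ : ∀ m, m = e₁.param (γ t) (Φ f) → ∀ u u' : EM, u = u' →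
        α (e₁.param (γ t) (Φ f)) u' = α m u := by
      rintro _ rfl _ _ rfl; rfl
    exact (h₂ _ hG.eq_of_nhds _ _ (DFunLike.congr_fun hd w)).trans (hgα w)
  have hmem₀ : ∀ w : EF, w ∈ (ξ.pullback EF (e₀.param (γ 0))).plane f ↔
      α (e₀.param (γ 0) f) (mfderiv 𝓘(ℝ, EF) 𝓘(ℝ, EM) (e₀.param (γ 0)) f w) = 0 := fun w ↦ by
    change _ ∈ ξ.plane _ ↔ _
    rw [hα.2]; exact Iff.rfl
  have hmem₁ : ∀ w : EF, w ∈ (ξ.pullback EF (e₁.param (γ t))).plane (Φ f) ↔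
      α (e₁.param (γ t) (Φ f))
        (mfderiv 𝓘(ℝ, EF) 𝓘(ℝ, EM) (e₁.param (γ t)) (Φ f) w) = 0 := fun w ↦ by
    change _ ∈ ξ.plane _ ↔ _
    rw [hα.2]; exact Iff.rfl
  have hiff : ∀ w : EF, D w ∈ (ξ.pullback EF (e₁.param (γ t))).plane (Φ f) ↔
      w ∈ (ξ.pullback EF (e₀.param (γ 0))).plane f := fun w ↦ by
    rw [hmem₁, hmem₀, hαD, mul_eq_zero, or_iff_right hg.ne']
  constructor
  · ext v
    constructor
    · rintro ⟨w, hw, rfl⟩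
      exact (hiff w).2 hw
    · intro hv
      obtain ⟨w, rfl⟩ := hDsurj v
      exact ⟨w, (hiff w).1 hv, rfl⟩
  · rintro _ ⟨k, hk, rfl⟩
    rw [(hα'.2 _).2] at hk
    obtain ⟨r, hr, rfl⟩ := hk
    refine ⟨(r * g) • α (e₀.param (γ 0) f), ?_, ?_⟩
    · rw [(hα'.2 _).2]
      exact ⟨r * g, mul_pos hr hg, rfl⟩
    · ext w
      exact (congrArg (r * ·) (hαD w)).trans (mul_assoc _ _ _).symm

end Fibres

/-- Reversal of a horizontal lift, after restriction to `[0, t]` and rescaling to `[0, 1]`. -/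
theorem IsHorizontalLift.reverse {H : ∀ m : M, Submodule ℝ (TangentSpace 𝓘(ℝ, EM) m)}
    {c : ℝ → M} (hc : IsHorizontalLift π H γ c) {t : ℝ} (ht : t ∈ Icc (0 : ℝ) 1) :
    IsHorizontalLift π H (fun r ↦ γ (t * (1 - r))) (fun r ↦ c (t * (1 - r))) := by
  have hmaps : MapsTo (fun r : ℝ ↦ t * (1 - r)) (Icc 0 1) (Icc 0 1) := fun r hr ↦
    ⟨mul_nonneg ht.1 (by linarith [hr.2]), mul_le_one₀ ht.2 (by linarith [hr.2])
      (by linarith [hr.1])⟩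
  intro r hr
  obtain ⟨h, v, hv, hd⟩ := hc _ (hmaps hr)
  refine ⟨h, (-t) • v, (H _).smul_mem _ hv, ?_⟩
  have h₁ : HasDerivWithinAt (fun r : ℝ ↦ t * (1 - r)) (-t) (Icc 0 1) r := by
    simpa using (((hasDerivAt_id r).const_sub 1).const_mul t).hasDerivWithinAt
  have h₂ := HasMFDerivWithinAt.comp (g := c) (f := fun r ↦ t * (1 - r)) (u := Icc 0 1) r hd
    (hasMFDerivWithinAt_iff_hasFDerivWithinAt.2 h₁.hasFDerivWithinAt) hmaps
  have h₃ : ∀ T : ℝ →L[ℝ] EM, ((1 : ℝ →L[ℝ] ℝ).smulRight (v : EM)).comp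
      (ContinuousLinearMap.toSpanSingleton ℝ (-t)) = T →
      HasMFDerivWithinAt 𝓘(ℝ, ℝ) 𝓘(ℝ, EM) (fun r ↦ c (t * (1 - r))) (Icc 0 1) r T := by
    rintro _ rfl
    exact h₂
  refine h₃ _ ?_
  ext
  simp

/-- Parallel transport of a complete connection is a diffeomorphism of the fibres; its inverse is
the parallel transport along the reversed path. -/
theorem IsParallelTransportOn.exists_diffeomorph (hπ : IsSmoothFiberBundle EM EB EF F π)
    (hξ : IsContactOnFibers EB EF F π ξ) (hα : ξ.IsKernelForm α)
    (hcomplete : IsCompleteConnection EB π (contactConnection EB π ξ α))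
    (hγ : ContMDiffOn 𝓘(ℝ, ℝ) 𝓘(ℝ, EB) ∞ γ (Icc 0 1)) {P : ℝ → M → M}
    (hP : IsParallelTransportOn π (contactConnection EB π ξ α) γ (π ⁻¹' {γ 0}) P)
    {t : ℝ} (ht : t ∈ Icc (0 : ℝ) 1)
    {e₀ e₁ : SmoothTrivialization EM EB EF F π} (h₀ : γ 0 ∈ e₀.baseSet) (h₁ : γ t ∈ e₁.baseSet) :
    ∃ Φ : F ≃ₘ^∞⟮𝓘(ℝ, EF), 𝓘(ℝ, EF)⟯ F, ⇑Φ = e₁.coord ∘ P t ∘ e₀.param (γ 0) := by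
  classical
  let δ : ℝ → B := fun r ↦ γ (t * (1 - r))
  have hδ₀ : δ 0 = γ t := by simp [δ]
  have hδ₁ : δ 1 = γ 0 := by simp [δ]
  have h01 : (0 : ℝ) ∈ Icc (0 : ℝ) 1 := left_mem_Icc.2 zero_le_one
  have h11 : (1 : ℝ) ∈ Icc (0 : ℝ) 1 := right_mem_Icc.2 zero_le_one
  have hδ : ContMDiffOn 𝓘(ℝ, ℝ) 𝓘(ℝ, EB) ∞ δ (Icc 0 1) := by
    have h : ContDiff ℝ ∞ fun r : ℝ ↦ t * (1 - r) := by fun_prop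
    refine hγ.comp h.contMDiff.contMDiffOn fun r hr ↦ ?_
    exact ⟨mul_nonneg ht.1 (by linarith [hr.2]), mul_le_one₀ ht.2 (by linarith [hr.2])
      (by linarith [hr.1])⟩
  choose! Q hQ using fun m hm ↦ hcomplete δ hδ m hm
  let P' : ℝ → M → M := fun r m ↦ Q m r
  have hPu : IsParallelTransportOn π (contactConnection EB π ξ α) γ (univ ∩ π ⁻¹' {γ 0}) P := by
    rwa [univ_inter]
  have hP' : IsParallelTransportOn π (contactConnection EB π ξ α) δ (univ ∩ π ⁻¹' {δ 0}) P' :=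
    fun m hm ↦ hQ m hm.2
  have h₀' : δ 1 ∈ e₀.baseSet := hδ₁ ▸ h₀
  have h₁' : δ 0 ∈ e₁.baseSet := hδ₀ ▸ h₁
  let Φ : F → F := e₁.coord ∘ P t ∘ e₀.param (γ 0)
  let Φ' : F → F := e₀.coord ∘ P' 1 ∘ e₁.param (δ 0)
  -- `P' 1` inverts `P t`
  have key : ∀ m n, π m = γ 0 → π n = γ t → (P t m = n ↔ P' 1 n = m) := by
    intro m n hm hn
    obtain ⟨e, hl⟩ := hP m hm
    obtain ⟨e', hl'⟩ := hQ n (hn.trans hδ₀.symm)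
    have hr := hl.reverse ht
    constructor
    · intro h
      have := IsHorizontalLift.apply_eq hπ hξ hα hδ hr hl' h01 h11 (by simpa [h] using e'.symm)
      simp only [sub_self, mul_zero, e] at this
      exact this.symm
    · intro h
      have h' : Q n 1 = m := h
      have := IsHorizontalLift.apply_eq hπ hξ hα hδ hr hl' h11 h01 (by simp [e, h'])
      simp only [sub_zero, mul_one] at this
      exact this.trans e'
  refine ⟨⟨⟨Φ, Φ', fun f ↦ ?_, fun f ↦ ?_⟩, fun f ↦ ?_, fun f ↦ ?_⟩, rfl⟩
  · have h := hPu.param_coord_eq ht h₀ h₁ (mem_univ (e₀.param (γ 0) f))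
    have h' := (key _ _ (e₀.proj_param h₀ f)
      (hPu.proj_eq ht h₀ (mem_univ (e₀.param (γ 0) f)))).1 rfl
    simp only [Φ, Φ', Function.comp_apply, hδ₀, h, h']
    exact e₀.coord_param h₀ f
  · have h := hP'.param_coord_eq h11 h₁' h₀' (mem_univ (e₁.param (δ 0) f))
    have h' := (key _ _ ((hP'.proj_eq h11 h₁' (mem_univ (e₁.param (δ 0) f))).trans hδ₁)
      ((e₁.proj_param h₁' f).trans hδ₀)).2 rfl
    rw [hδ₁] at h
    simp only [Φ, Φ', Function.comp_apply, h, h']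
    exact e₁.coord_param h₁' f
  · exact hPu.contMDiffAt_coord hπ hξ hα hγ isOpen_univ ht h₀ h₁ (mem_univ _)
  · exact hP'.contMDiffAt_coord hπ hξ hα hδ isOpen_univ h11 h₁' h₀' (mem_univ _)

end GlobalTransport

end ContactBundle

end

theorem lemma2p2
    {EM EB EF : Type*}
    [NormedAddCommGroup EM] [NormedSpace ℝ EM] [FiniteDimensional ℝ EM]
    [NormedAddCommGroup EB] [NormedSpace ℝ EB] [FiniteDimensional ℝ EB]
    [NormedAddCommGroup EF] [NormedSpace ℝ EF] [FiniteDimensional ℝ EF]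
    {M B F : Type*}
    [TopologicalSpace M] [T2Space M] [ChartedSpace EM M] [IsManifold 𝓘(ℝ, EM) ∞ M]
    [TopologicalSpace B] [T2Space B] [ChartedSpace EB B] [IsManifold 𝓘(ℝ, EB) ∞ B]
    [TopologicalSpace F] [T2Space F] [ChartedSpace EF F] [IsManifold 𝓘(ℝ, EF) ∞ F]
    (π : M → B) (hπ : ContactBundle.IsSmoothFiberBundle EM EB EF F π)
    (ξ : ContactBundle.CoorientedField EM M) (hξ : ξ.IsCoorientedDistribution)
    (hcontact : ContactBundle.IsContactOnFibers EB EF F π ξ) :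
    ∃ H : ∀ m : M, Submodule ℝ (TangentSpace 𝓘(ℝ, EM) m),
      -- `H = (ξ ∩ V)^{dα|ξ}`, whichever form `α` with kernel `ξ` is used
      (∀ α, ξ.IsKernelForm α →
        ∀ m, (H m : Set (TangentSpace 𝓘(ℝ, EM) m)) = ContactBundle.contactPerp EB π ξ α m) ∧
      ContactBundle.IsConnection EB π H ∧
      -- wherever it exists, parallel transport along a path `γ` is a co-orientation preserving
      -- contact embedding of (an open part of) the fibre over `γ 0` into the fibre over `γ t`
      (∀ γ : ℝ → B, ContMDiffOn 𝓘(ℝ, ℝ) 𝓘(ℝ, EB) ∞ γ (Set.Icc 0 1) →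
        ∀ (O : Set M) (P : ℝ → M → M), IsOpen O →
        ContactBundle.IsParallelTransportOn π H γ (O ∩ π ⁻¹' {γ 0}) P →
        ∀ t ∈ Set.Icc (0 : ℝ) 1,
        ∀ e₀ e₁ : ContactBundle.SmoothTrivialization EM EB EF F π,
        γ 0 ∈ e₀.baseSet → γ t ∈ e₁.baseSet →
          ContMDiffOn 𝓘(ℝ, EF) 𝓘(ℝ, EF) ∞ (e₁.coord ∘ P t ∘ e₀.param (γ 0))
            (e₀.param (γ 0) ⁻¹' O) ∧
          Set.InjOn (e₁.coord ∘ P t ∘ e₀.param (γ 0)) (e₀.param (γ 0) ⁻¹' O) ∧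
          ContactBundle.PreservesOn (ξ.pullback EF (e₀.param (γ 0))) (ξ.pullback EF (e₁.param (γ t)))
            (e₁.coord ∘ P t ∘ e₀.param (γ 0)) (e₀.param (γ 0) ⁻¹' O)) ∧
      -- if `H` is complete, then parallel transport is moreover a diffeomorphism between the fibres
      (ContactBundle.IsCompleteConnection EB π H →
        ∀ γ : ℝ → B, ContMDiffOn 𝓘(ℝ, ℝ) 𝓘(ℝ, EB) ∞ γ (Set.Icc 0 1) →
        ∀ P : ℝ → M → M, ContactBundle.IsParallelTransportOn π H γ (π ⁻¹' {γ 0}) P →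
        ∀ t ∈ Set.Icc (0 : ℝ) 1,
        ∀ e₀ e₁ : ContactBundle.SmoothTrivialization EM EB EF F π,
        γ 0 ∈ e₀.baseSet → γ t ∈ e₁.baseSet →
          ∃ Φ : F ≃ₘ^∞⟮𝓘(ℝ, EF), 𝓘(ℝ, EF)⟯ F, ⇑Φ = e₁.coord ∘ P t ∘ e₀.param (γ 0)) := by
  obtain ⟨α, hα⟩ := hξ
  refine ⟨ContactBundle.contactConnection EB π ξ α, fun α' hα' m ↦ ?_,
    ContactBundle.isConnection_contactConnection hπ hcontact hα.1,
    fun γ hγ O P hO hP t ht e₀ e₁ h₀ h₁ ↦ ⟨fun f hf ↦ ?_, ?_, ?_⟩,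
    fun hcomplete γ hγ P hP t ht e₀ e₁ h₀ h₁ ↦
      hP.exists_diffeomorph hπ hcontact hα.1 hcomplete hγ ht h₀ h₁⟩
  · exact hα.1.contactPerp_eq hα' (hα.2 m).1
  · exact (hP.contMDiffAt_coord hπ hcontact hα.1 hγ hO ht h₀ h₁ hf).contMDiffWithinAt
  · exact hP.injOn_coord hπ hcontact hα.1 hγ ht h₀ h₁
  · exact hP.preservesOn hπ hcontact hγ hO ht h₀ h₁ hα
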